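/- Let $n\ge 7$ be an integer. Define the Joseph–Lundgren exponent $$p_c(n)=\begin{cases}\infty & n\le 14,\\[2pt] \dfrac{n+4-2d(n)}{n-8-2d(n)} & n\ge 15,\end{cases}\qquad d(n)=\frac16\Big(9n^2+96-\frac{1536+1152n^2}{d_0(n)}-\frac32 d_0(n)\Big)^{1/2},$$ where $d_0(n)=-\big(d_1(n)+36\sqrt{d_2(n)}\big)^{1/3}$ (real cube root) and $$d_1(n)=-94976+20736n+103104n^2-10368n^3-3024n^4+1296n^5-108n^6,$$ $$\begin{aligned}d_2(n)={}&6131712-3039232n-16644096n^2+4818944n^3+6915840n^4-1936384n^5-690432n^6\\&+251136n^7-30864n^8-4320n^9+1800n^{10}-216n^{11}+9n^{12}.\end{aligned}$$ **Theorem 4.1.** Let $p\in\mathbb{R}$ satisfy $\frac{n+6}{n-6}<p<p_c(n)$. Let $u\in W^{3,2}_{loc}(\mathbb{R}^n\setminus\{0\})$ be real-valued with $|u|^{p+1}\in L^1_{loc}(\mathbb{R}^n\setminus\{0\})$, and suppose that 1. $u$ is homogeneous: there is a function $w$ on the unit sphere $S^{n-1}$ with $u(x)=|x|^{-6/(p-1)}\,w(x/|x|)$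 for almost every $x$; 2. $u$ is a weak solution of $(-\Delta)^3u=|u|^{p-1}u$ in $\mathbb{R}^n\setminus\{0\}$, that is, $$\int_{\mathbb{R}^n}\nabla\Delta u\cdot\nabla\Delta\varphi\,dx=\int_{\mathbb{R}^n}|u|^{p-1}u\,\varphi\,dx\qquad\text{for all }\varphi\in C_c^\infty(\mathbb{R}^n\setminus\{0\});$$ 3. $u$ is stable, that is, $$p\int_{\mathbb{R}^n}|u|^{p-1}\varphi^2\,dx\le\int_{\mathbb{R}^n}|\nabla\Delta\varphi|^2\,dx\qquad\text{for all }\varphi\in C_c^\infty(\mathbb{R}^n\setminus\{0\}).$$ Then $u=0$ almost everywhere in $\mathbb{R}^n$. -/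

import Mathlib

open MeasureTheory
open scoped ContDiff Laplacian RealInnerProductSpace

noncomputable section

namespace Triharmonic

/-- `ℝⁿ` with its Euclidean norm and Lebesgue measure. -/
abbrev E (n : ℕ) : Type := EuclideanSpace ℝ (Fin n)

/-! ### Function spaces -/

/-- `φ ∈ C_c^∞(Ω)`. -/
def IsTestFunction {n : ℕ} (Ω : Set (E n)) (φ : E n → ℝ) : Prop :=
  ContDiff ℝ ∞ φ ∧ HasCompactSupport φ ∧ tsupport φ ⊆ Ω

/-- `f ∈ L²_loc(Ω)`: `f` is square integrable on every compact subset of `Ω`. -/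
def MemL2Loc {n : ℕ} {F : Type*} [NormedAddCommGroup F] (Ω : Set (E n)) (f : E n → F) : Prop :=
  ∀ K : Set (E n), IsCompact K → K ⊆ Ω → MemLp f 2 (volume.restrict K)

/-- `v` is the weak partial derivative `∂ᵢ u` on `Ω`. -/
def IsWeakPartial {n : ℕ} (Ω : Set (E n)) (i : Fin n) (u v : E n → ℝ) : Prop :=
  ∀ φ : E n → ℝ, IsTestFunction Ω φ →
    ∫ x, u x * fderiv ℝ φ x (EuclideanSpace.single i 1) = - ∫ x, v x * φ x

/-- `u ∈ W^{m,2}_loc(Ω)`: `u ∈ L²_loc(Ω)` and all weak derivatives of `u` of order at most `m`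
exist and lie in `L²_loc(Ω)`. -/
def MemW2Loc {n : ℕ} (Ω : Set (E n)) : ℕ → (E n → ℝ) → Prop
  | 0, u => MemL2Loc Ω u
  | m + 1, u => MemL2Loc Ω u ∧ ∀ i : Fin n, ∃ v : E n → ℝ, IsWeakPartial Ω i u v ∧ MemW2Loc Ω m v

/-! ### The equation and stability -/

/-- `G ∈ L²_loc(Ω; ℝⁿ)` is the weak derivative `∇Δu` on `Ω`; it is unique up to null sets. -/
def IsWeakGradLaplacian {n : ℕ} (Ω : Set (E n)) (u : E n → ℝ) (G : E n → E n) : Prop :=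
  MemL2Loc Ω G ∧ ∀ φ : E n → ℝ, IsTestFunction Ω φ →
    ∫ x, φ x • G x = - ∫ x, u x • gradient (Δ φ) x

/-- `u` is a weak solution of `(-Δ)³ u = |u|^{p-1} u` on `Ω`:
`∫ ∇Δu · ∇Δφ = ∫ |u|^{p-1} u φ` for all `φ ∈ C_c^∞(Ω)`. -/
def IsWeakSolution {n : ℕ} (Ω : Set (E n)) (p : ℝ) (u : E n → ℝ) : Prop :=
  ∃ G : E n → E n, IsWeakGradLaplacian Ω u G ∧
    ∀ φ : E n → ℝ, IsTestFunction Ω φ →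
      ∫ x, ⟪G x, gradient (Δ φ) x⟫ = ∫ x, |u x| ^ (p - 1) * u x * φ x

/-- `u` is stable on `Ω`: `p ∫ |u|^{p-1} φ² ≤ ∫ |∇Δφ|²` for all `φ ∈ C_c^∞(Ω)`. -/
def IsStable {n : ℕ} (Ω : Set (E n)) (p : ℝ) (u : E n → ℝ) : Prop :=
  ∀ φ : E n → ℝ, IsTestFunction Ω φ →
    p * ∫ x, |u x| ^ (p - 1) * φ x ^ 2 ≤ ∫ x, ‖gradient (Δ φ) x‖ ^ 2

/-! ### The Joseph-Lundgren exponent -/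

/-- The real cube root, also of negative numbers. -/
def realCbrt (y : ℝ) : ℝ := if 0 ≤ y then y ^ (1 / 3 : ℝ) else -((-y) ^ (1 / 3 : ℝ))

def d₁ (n : ℝ) : ℝ :=
  -94976 + 20736 * n + 103104 * n ^ 2 - 10368 * n ^ 3 + 1296 * n ^ 5 - 3024 * n ^ 4 - 108 * n ^ 6

def d₂ (n : ℝ) : ℝ :=
  6131712 - 16644096 * n ^ 2 + 6915840 * n ^ 4 - 690432 * n ^ 6 - 3039232 * n
    + 4818944 * n ^ 3 - 1936384 * n ^ 5 + 251136 * n ^ 7 - 30864 * n ^ 8 - 4320 * n ^ 9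
    + 1800 * n ^ 10 - 216 * n ^ 11 + 9 * n ^ 12

def d₀ (n : ℝ) : ℝ := - realCbrt (d₁ n + 36 * √(d₂ n))

def d (n : ℝ) : ℝ :=
  1 / 6 * √(9 * n ^ 2 + 96 - (1536 + 1152 * n ^ 2) / d₀ n - 3 / 2 * d₀ n)

/-- The exponent `p_c(n) ∈ (1, ∞]`. -/
def josephLundgrenExponent (n : ℕ) : EReal :=
  if n ≤ 14 then ⊤ else (((n + 4 - 2 * d n) / (n - 8 - 2 * d n) : ℝ) : EReal)

end Triharmonic

end

noncomputable section

namespace Triharmonic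

/-! Write `u = r^(-k) w(θ)` with `k = 6 / (p - 1)`, and let `L` be the Laplacian of the sphere. On
separated functions `r^a η(log r) q(θ)` the Euclidean Laplacian is `r^(-2)` times a polynomial in `d
/ d(log r)` plus `L`, so both hypotheses on `u` descend to the sphere. The equation becomes `∫
|w|^(p-1) w q = ⟨w, A q⟩` with `A = (c₁ - L)(c₂ - L)(c₃ - L)` (`sphere_equation`). Stability, tested
at the borderline degree `3 - n/2` with `η` spread out over longer and longer logarithmic scales,
becomes `p ∫ |w|^(p-1) q² ≤ ⟨q, B q⟩` with `B = (b₁ - L)(b₂ - L)(b₁ - L)` (`sphere_stability`).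
Since `-L ≥ 0`, it is enough to compare `A` and `B` coefficient by coefficient in powers of `-L`.
Below the Joseph–Lundgren exponent, `B ≤ κ p A` for some `κ < 1` (`symbol_ineq`). The exponent
enters only through the constant coefficients; the other comparisons follow from that one. Formally
`q = w` now gives `∫ |w|^(p+1) ≤ κ ∫ |w|^(p+1)`, hence `w = 0`. As `w` is not known to be smooth, it
is replaced by its `L²` projections onto `L`-invariant spaces of polynomials
(`HomZero.exists_approx`), and Fatou's lemma passes to the limit (`angular_eq_zero`). -/

/-! ### The Joseph–Lundgren exponent and the comparison of symbols -/

/-- The symmetric-function form of the cubic behind the Joseph–Lundgren exponent. -/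
theorem cubic_eq_depressed (ν S : ℝ) :
    ((ν / 2) ^ 2 - S) * ((ν / 2 + 2) ^ 2 - S) * ((ν / 2 - 2) ^ 2 - S)
        - ((ν / 2 - 3) * (ν / 2 - 1) * (ν / 2 + 1)) ^ 2
      = -((36 * S - 9 * ν ^ 2 - 96) ^ 3
          - 9 / 2 * (1536 + 1152 * ν ^ 2) * (36 * S - 9 * ν ^ 2 - 96)
          - 27 / 4 * d₁ ν) / 36 ^ 3 := by
  unfold d₁; ring

/-- The product of the two conjugates `d₁ ± 36 √d₂` of Cardano's formula. Its positivity gives `36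
√d₂ < |d₁|`, and it turns the reciprocal of `d₀³` into the other conjugate. -/
theorem d₁_sq_sub (ν : ℝ) :
    d₁ ν ^ 2 - 1296 * d₂ ν = 8 / 27 * (1536 + 1152 * ν ^ 2) ^ 3 := by
  unfold d₁ d₂; ring

theorem d₁_neg {ν : ℝ} (h : 15 ≤ ν) : d₁ ν < 0 := by
  -- Expanded around 15, all coefficients have the same sign; the same shift serves for `d₂`.
  obtain ⟨m, hm, rfl⟩ : ∃ m : ℝ, 0 ≤ m ∧ ν = m + 15 := ⟨ν - 15, by linarith, by ring⟩
  have : d₁ (m + 15) = -(410705036 + 208733544 * m + 42718356 * m ^ 2 + 4565808 * m ^ 3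
      + 270324 * m ^ 4 + 8424 * m ^ 5 + 108 * m ^ 6) := by unfold d₁; ring
  rw [this]; have : 0 < 410705036 + 208733544 * m + 42718356 * m ^ 2 + 4565808 * m ^ 3
      + 270324 * m ^ 4 + 8424 * m ^ 5 + 108 * m ^ 6 := by positivity
  linarith

theorem d₂_nonneg {ν : ℝ} (h : 15 ≤ ν) : 0 ≤ d₂ ν := by
  obtain ⟨m, hm, rfl⟩ : ∃ m : ℝ, 0 ≤ m ∧ ν = m + 15 := ⟨ν - 15, by linarith, by ring⟩
  have : d₂ (m + 15) = 126100750123257 + 130684714202588 * m + 60426347513634 * m ^ 2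
      + 16630573432844 * m ^ 3 + 3048957353415 * m ^ 4 + 393377921336 * m ^ 5
      + 36687653148 * m ^ 6 + 2494830456 * m ^ 7 + 122860311 * m ^ 8 + 4275180 * m ^ 9
      + 99810 * m ^ 10 + 1404 * m ^ 11 + 9 * m ^ 12 := by unfold d₂; ring
  rw [this]; positivity

theorem realCbrt_of_neg {y : ℝ} (h : y < 0) : -realCbrt y = (-y) ^ (1 / 3 : ℝ) := by
  simp [realCbrt, not_le.mpr h]

theorem d₁_add_sqrt_neg {ν : ℝ} (h : 15 ≤ ν) : d₁ ν + 36 * √(d₂ ν) < 0 := by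
  have h1 := d₁_neg h
  have h2 := Real.sq_sqrt (d₂_nonneg h)
  have h3 := d₁_sq_sub ν
  have h4 : 0 < 8 / 27 * (1536 + 1152 * ν ^ 2) ^ 3 := by positivity
  nlinarith [Real.sqrt_nonneg (d₂ ν)]

theorem d₀_pos {ν : ℝ} (h : 15 ≤ ν) : 0 < d₀ ν := by
  rw [d₀, realCbrt_of_neg (d₁_add_sqrt_neg h)]
  exact Real.rpow_pos_of_pos (by linarith [d₁_add_sqrt_neg h]) _

theorem d₀_cube {ν : ℝ} (h : 15 ≤ ν) : d₀ ν ^ 3 = -(d₁ ν + 36 * √(d₂ ν)) := by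
  rw [d₀, realCbrt_of_neg (d₁_add_sqrt_neg h), ← Real.rpow_natCast, ← Real.rpow_mul]
  · norm_num
  · linarith [d₁_add_sqrt_neg h]

/-- The two summands are Cardano's `α` and `β`: their cubes are `27/8 (d₁ - 36 √d₂)` and `27/8 (d₁ +
36 √d₂)`, and their sum is the real root of the depressed cubic. -/
theorem cardano_cubes {ν : ℝ} (h : 15 ≤ ν) :
    (-((1536 + 1152 * ν ^ 2) / d₀ ν)) ^ 3 + (-(3 / 2 * d₀ ν)) ^ 3 = 27 / 4 * d₁ ν := by
  have h0 := d₀_pos h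
  have h1 := d₀_cube h
  have h2 := Real.sq_sqrt (d₂_nonneg h)
  have h3 := d₁_sq_sub ν
  have h4 : (-((1536 + 1152 * ν ^ 2) / d₀ ν)) ^ 3 = 27 / 8 * (d₁ ν - 36 * √(d₂ ν)) := by
    rw [neg_pow, div_pow, h1]
    have : d₁ ν + 36 * √(d₂ ν) ≠ 0 := (d₁_add_sqrt_neg h).ne
    field_simp
    nlinarith
  rw [h4, neg_pow, mul_pow, h1]; ring

/-- The sign of the cubic below the explicit root `36 * d ^ 2` of Cardano's formula. -/
theorem cubic_pos_of_lt {ν S : ℝ} (h : 15 ≤ ν)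
    (hS : 36 * S < 9 * ν ^ 2 + 96 - (1536 + 1152 * ν ^ 2) / d₀ ν - 3 / 2 * d₀ ν) :
    ((ν / 2 - 3) * (ν / 2 - 1) * (ν / 2 + 1)) ^ 2
      < ((ν / 2) ^ 2 - S) * ((ν / 2 + 2) ^ 2 - S) * ((ν / 2 - 2) ^ 2 - S) := by
  have h0 := d₀_pos h
  have h1 := cubic_eq_depressed ν S
  rw [← cardano_cubes h] at h1
  set α := -((1536 + 1152 * ν ^ 2) / d₀ ν) with hα
  set β := -(3 / 2 * d₀ ν) with hβ
  have hαn : α < 0 := by rw [hα]; have : 0 < (1536 + 1152 * ν ^ 2) / d₀ ν := by positivity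
                         linarith
  have hβn : β < 0 := by rw [hβ]; linarith
  have hαβ : 9 / 2 * (1536 + 1152 * ν ^ 2) = 3 * (α * β) := by rw [hα, hβ]; field_simp; ring
  set y := 36 * S - 9 * ν ^ 2 - 96 with hy
  have hlt : y < α + β := by rw [hy, hα, hβ]; linarith
  rw [hαβ] at h1
  -- The quadratic cofactor of the root `α + β` is a sum of squares, so the cubic changes sign only
  -- there.
  have h2 : y ^ 3 - 3 * (α * β) * y - (α ^ 3 + β ^ 3)
      = (y - (α + β)) * ((y + (α + β) / 2) ^ 2 + 3 / 4 * (α - β) ^ 2) := by ring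
  have h3 : 0 < (y + (α + β) / 2) ^ 2 + 3 / 4 * (α - β) ^ 2 := by
    have : y + (α + β) / 2 ≠ 0 := by linarith
    positivity
  have h4 := mul_neg_of_neg_of_pos (sub_neg.mpr hlt) h3
  rw [h2] at h1
  linarith

/-- The converse direction of the sign analysis. At `S = 1` it shows that the radicand in `d`
exceeds 36, so that `d > 1`. -/
theorem lt_of_cubic_pos {ν S : ℝ} (h : 15 ≤ ν)
    (hS : ((ν / 2 - 3) * (ν / 2 - 1) * (ν / 2 + 1)) ^ 2
      < ((ν / 2) ^ 2 - S) * ((ν / 2 + 2) ^ 2 - S) * ((ν / 2 - 2) ^ 2 - S)) :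
    36 * S < 9 * ν ^ 2 + 96 - (1536 + 1152 * ν ^ 2) / d₀ ν - 3 / 2 * d₀ ν := by
  have h0 := d₀_pos h
  have h1 := cubic_eq_depressed ν S
  rw [← cardano_cubes h] at h1
  set α := -((1536 + 1152 * ν ^ 2) / d₀ ν) with hα
  set β := -(3 / 2 * d₀ ν) with hβ
  have hαβ : 9 / 2 * (1536 + 1152 * ν ^ 2) = 3 * (α * β) := by rw [hα, hβ]; field_simp; ring
  set y := 36 * S - 9 * ν ^ 2 - 96 with hy
  rw [hαβ] at h1
  have h2 : y ^ 3 - 3 * (α * β) * y - (α ^ 3 + β ^ 3)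
      = (y - (α + β)) * ((y + (α + β) / 2) ^ 2 + 3 / 4 * (α - β) ^ 2) := by ring
  have h3 : 0 ≤ (y + (α + β) / 2) ^ 2 + 3 / 4 * (α - β) ^ 2 := by positivity
  rw [h2] at h1
  by_contra hc
  have : 0 ≤ y - (α + β) := by rw [hy, hα, hβ]; linarith
  have := mul_nonneg this h3
  linarith

/-- With `N = n / 2`, the point `S = 1` is the critical exponent `p = (n + 6) / (n - 6)`, where `k =
N - 3`. There the right side is `p` times the left, and `p > 1`. -/
theorem cubic_pos_at_one {N : ℝ} (h : 3 < N) :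
    ((N - 3) * (N - 1) * (N + 1)) ^ 2
      < (N ^ 2 - 1) * ((N + 2) ^ 2 - 1) * ((N - 2) ^ 2 - 1) := by
  have : (N ^ 2 - 1) * ((N + 2) ^ 2 - 1) * ((N - 2) ^ 2 - 1)
      - ((N - 3) * (N - 1) * (N + 1)) ^ 2 = 6 * ((N - 1) * (N + 1)) ^ 2 * (N - 3) := by ring
  have h2 : 0 < 6 * ((N - 1) * (N + 1)) ^ 2 * (N - 3) := by
    have : 0 < N - 3 := by linarith
    have : 0 < N - 1 := by linarith
    positivity
  linarith

theorem cubic_antitone {N S T : ℝ} (hN : 3 < N) (hST : S ≤ T) (hT : T ≤ (N - 2) ^ 2) :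
    (N ^ 2 - T) * ((N + 2) ^ 2 - T) * ((N - 2) ^ 2 - T)
      ≤ (N ^ 2 - S) * ((N + 2) ^ 2 - S) * ((N - 2) ^ 2 - S) := by
  have h1 : 0 ≤ N ^ 2 - T := by nlinarith
  have h2 : 0 ≤ (N + 2) ^ 2 - T := by nlinarith
  have h3 : 0 ≤ (N - 2) ^ 2 - T := by linarith
  have h4 : 0 ≤ N ^ 2 - S := by linarith
  have h5 : 0 ≤ (N + 2) ^ 2 - S := by linarith
  gcongr

/-- The cubic at `(n / 2 - 4 - k)²`, where `k = 6 / (p - 1)`, exceeds the Hardy–Rellich constant for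
exponents below the Joseph–Lundgren exponent. -/
theorem cubic_pos_of_lt_josephLundgrenExponent {n : ℕ} (hn : 7 ≤ n) {p : ℝ}
    (hp : ((n : ℝ) + 6) / ((n : ℝ) - 6) < p) (hpc : (p : EReal) < josephLundgrenExponent n) :
    ((n / 2 - 3) * (n / 2 - 1) * (n / 2 + 1)) ^ 2
      < (((n : ℝ) / 2) ^ 2 - (n / 2 - 4 - 6 / (p - 1)) ^ 2)
        * ((n / 2 + 2) ^ 2 - (n / 2 - 4 - 6 / (p - 1)) ^ 2)
        * ((n / 2 - 2) ^ 2 - (n / 2 - 4 - 6 / (p - 1)) ^ 2) := by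
  have hn' : (7 : ℝ) ≤ n := by exact_mod_cast hn
  have hp1 : 1 < p := lt_trans (by rw [lt_div_iff₀] <;> linarith) hp
  rw [div_lt_iff₀ (by linarith)] at hp
  set k := 6 / (p - 1) with hk
  have hk0 : 0 < k := div_pos (by norm_num) (by linarith)
  have hk1 : k < n / 2 - 3 := by rw [hk, div_lt_iff₀ (by linarith)]; nlinarith
  unfold josephLundgrenExponent at hpc
  have hN : (3 : ℝ) < n / 2 := by linarith
  split_ifs at hpc with h14
  · rcases le_or_gt n 10 with h10 | h10
    · have h10' : (n : ℝ) ≤ 10 := by exact_mod_cast h10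
      -- Here `-1 < n / 2 - 4 - k < 1`, so monotonicity in `S` reduces to `S = 1`.
      refine (cubic_pos_at_one hN).trans_le (cubic_antitone hN ?_ ?_) <;> nlinarith
    -- The worst case is `k → 0`, that is `p → ∞`; it is checked numerically in dimensions 11 to 14.
    · refine lt_of_lt_of_le ?_ (cubic_antitone hN (T := ((n : ℝ) / 2 - 4) ^ 2) ?_ ?_)
      · interval_cases n <;> norm_num
      · have h10' : (11 : ℝ) ≤ n := by exact_mod_cast h10
        nlinarith
      · nlinarith
  · have hn15 : (15 : ℝ) ≤ n := by exact_mod_cast (by omega : 15 ≤ n)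
    have hQ := lt_of_cubic_pos hn15 (S := 1) (cubic_pos_at_one hN)
    apply cubic_pos_of_lt hn15
    set Q := 9 * (n : ℝ) ^ 2 + 96 - (1536 + 1152 * (n : ℝ) ^ 2) / d₀ n - 3 / 2 * d₀ n with hQd
    have hd : d n = 1 / 6 * √Q := rfl
    have hd2 : 36 * d n ^ 2 = Q := by
      rw [hd, mul_pow, Real.sq_sqrt (by linarith)]; ring
    have hd0 : 0 ≤ d n := by rw [hd]; positivity
    have hd1 : 1 < d n := by nlinarith
    have hpc' : p < (n + 4 - 2 * d n) / (n - 8 - 2 * d n) := by exact_mod_cast hpc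
    rw [← hd2]
    -- The lower bound `-d n < n / 2 - 4 - k` is automatic, since `k < n / 2 - 3` and `d n > 1`.
    suffices h : (n : ℝ) / 2 - 4 - k < d n by nlinarith
    -- If the denominator of `p_c` is not positive, `k > 0` is enough; otherwise `p < p_c`
    -- rearranges to the claim.
    rcases le_or_gt ((n : ℝ) - 8 - 2 * d n) 0 with hle | hgt
    · linarith
    · rw [lt_div_iff₀ hgt] at hpc'
      have : (n : ℝ) / 2 - 4 - d n < k := by
        rw [hk, lt_div_iff₀ (by linarith)]; linarith
      linarith

/-- Divided by the triple products, this compares sums of reciprocals of `b = (X, X + 4, X)` and `c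
= (Z - 4t, Z + 4, Z + 4t)`: passing from `X` to `Z ≤ X` and spreading two entries by `±4t` both
increase the sum. Hence `e₂(b) / e₂(c) ≤ e₃(b) / e₃(c)`. -/
theorem esymm_two_mul_le {X Z t : ℝ} (ht : 0 ≤ t) (hZ : 4 * t < Z) (hZX : Z ≤ X) :
    (X * (X + 4) + (X + 4) * X + X * X) * ((Z - 4 * t) * (Z + 4) * (Z + 4 * t))
      ≤ ((Z - 4 * t) * (Z + 4) + (Z + 4) * (Z + 4 * t) + (Z - 4 * t) * (Z + 4 * t))
        * (X * (X + 4) * X) := by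
  obtain ⟨P, hP⟩ : ∃ P, P = (Z - 4 * t) * (Z + 4 * t) := ⟨_, rfl⟩
  have hZ0 : 0 < Z := by linarith
  have hX0 : 0 < X := by linarith
  have hP0 : 0 ≤ P := by rw [hP]; exact mul_nonneg (by linarith) (by linarith)
  have hPZ : P ≤ Z * X := by
    have : P = Z * Z - 16 * t ^ 2 := by rw [hP]; ring
    have : Z * Z ≤ Z * X := by gcongr
    have : 0 ≤ t ^ 2 := by positivity
    linarith
  have q1 : (X * X) * (P * (Z + 4)) ≤ (X * X) * (P * (X + 4)) := by gcongr
  have q2 : 2 * (X * (X + 4)) * (Z + 4) * P ≤ 2 * (X * (X + 4)) * (Z + 4) * (Z * X) := by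
    gcongr
  calc _ = 2 * (X * (X + 4)) * (Z + 4) * P + (X * X) * (P * (Z + 4)) := by rw [hP]; ring
    _ ≤ 2 * (X * (X + 4)) * (Z + 4) * (Z * X) + (X * X) * (P * (X + 4)) := add_le_add q2 q1
    _ = _ := by rw [hP]; ring

/-- The next link of the chain: `e₁(b) / e₁(c) ≤ e₂(b) / e₂(c)`. -/
theorem esymm_one_mul_le {X Z t : ℝ} (ht : 0 ≤ t) (hZ : 4 * t < Z) (hZX : Z ≤ X) :
    (X + (X + 4) + X)
        * ((Z - 4 * t) * (Z + 4) + (Z + 4) * (Z + 4 * t) + (Z - 4 * t) * (Z + 4 * t))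
      ≤ ((Z - 4 * t) + (Z + 4) + (Z + 4 * t)) * (X * (X + 4) + (X + 4) * X + X * X) := by
  have hZ0 : 0 < Z := by linarith
  have hX0 : 0 < X := by linarith
  have hXZ : 0 ≤ X - Z := by linarith
  have h : 0 ≤ 9 * (X * Z) * (X - Z) + 12 * ((X - Z) * (X + Z)) + 32 * (X - Z)
      + 16 * t ^ 2 * (3 * X + 4) := by positivity
  linear_combination h

/-- The symbols of `(-Δ)³` on degree `-k` homogeneous functions dominate, after multiplication by
`p`, those at the Hardy exponent `(n - 6) / 2`. -/
theorem symbol_ineq {n : ℕ} (hn : 7 ≤ n) {p : ℝ}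
    (hp : ((n : ℝ) + 6) / ((n : ℝ) - 6) < p) (hpc : (p : EReal) < josephLundgrenExponent n)
    {k c₁ c₂ c₃ b₁ b₂ : ℝ} (hk : k = 6 / (p - 1)) (hc₁ : c₁ = k * (n - 2 - k))
    (hc₂ : c₂ = (k + 2) * (n - 4 - k)) (hc₃ : c₃ = (k + 4) * (n - 6 - k))
    (hb₁ : b₁ = (n / 2 - 3) * (n / 2 + 1)) (hb₂ : b₂ = (n / 2 - 1) ^ 2) :
    ∃ κ : ℝ, 0 < κ ∧ κ < 1 ∧ 1 ≤ κ * p ∧ b₁ + b₂ + b₁ ≤ κ * p * (c₁ + c₂ + c₃) ∧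
      b₁ * b₂ + b₂ * b₁ + b₁ * b₁ ≤ κ * p * (c₁ * c₂ + c₂ * c₃ + c₁ * c₃) ∧
      b₁ * b₂ * b₁ ≤ κ * p * (c₁ * c₂ * c₃) := by
  have hn' : (7 : ℝ) ≤ n := by exact_mod_cast hn
  have hcub := cubic_pos_of_lt_josephLundgrenExponent hn hp hpc
  have hp1 : 1 < p := lt_trans (by rw [lt_div_iff₀] <;> linarith) hp
  rw [div_lt_iff₀ (by linarith)] at hp
  rw [← hk] at hcub
  have hk0 : 0 < k := hk ▸ div_pos (by norm_num) (by linarith)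
  have hk1 : k < n / 2 - 3 := by rw [hk, div_lt_iff₀ (by linarith)]; nlinarith
  have hpk : p * k = k + 6 := by rw [hk]; have : p - 1 ≠ 0 := by linarith
                                 field_simp; ring
  -- `t` measures how far `k` lies below the Hardy exponent `(n - 6) / 2`; at `t = 0` the `cᵢ`
  -- reduce to `b₁, b₂, b₁`.
  obtain ⟨t, ht⟩ : ∃ t, t = (n : ℝ) / 2 - 3 - k := ⟨_, rfl⟩
  have ht0 : 0 < t := by linarith
  obtain ⟨X, hX⟩ : ∃ X, X = b₁ := ⟨_, rfl⟩
  obtain ⟨Z, hZ⟩ : ∃ Z, Z = X - t ^ 2 := ⟨_, rfl⟩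
  have hb₂X : b₂ = X + 4 := by rw [hb₂, hX, hb₁]; ring
  have hc₁Z : c₁ = Z - 4 * t := by rw [hc₁, hZ, ht, hX, hb₁]; ring
  have hc₃Z : c₃ = Z + 4 * t := by rw [hc₃, hZ, ht, hX, hb₁]; ring
  have hc₂Z : c₂ = Z + 4 := by rw [hc₂, hZ, ht, hX, hb₁]; ring
  have hc₁0 : 0 < c₁ := by rw [hc₁]; exact mul_pos hk0 (by linarith)
  have hX0 : 0 < X := by rw [hX, hb₁]; exact mul_pos (by linarith) (by linarith)
  have hZ4 : 4 * t < Z := by linarith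
  have hZX : Z < X := by rw [hZ]; nlinarith
  have hc₂0 : 0 < c₂ := by linarith
  have hc₃0 : 0 < c₃ := by linarith
  -- Since `p k = k + 6`, multiplying by `p` replaces the factor `k` of `c₁` by `k + 6`, and the
  -- product becomes the cubic already estimated.
  have hE3 : b₁ * b₂ * b₁ < p * (c₁ * c₂ * c₃) := by
    calc b₁ * b₂ * b₁ = ((n / 2 - 3) * (n / 2 - 1) * (n / 2 + 1)) ^ 2 := by rw [hb₁, hb₂]; ring
      _ < _ := hcub
      _ = (p * k) * ((n - 2 - k) * c₂ * c₃) := by rw [hpk, hc₂, hc₃]; ring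
      _ = _ := by rw [hc₁]; ring
  rw [← hX, hb₂X] at *
  have e3 : 0 < X * (X + 4) * X := by positivity
  have a3 : 0 < c₁ * c₂ * c₃ := by positivity
  have a2 : 0 < c₁ * c₂ + c₂ * c₃ + c₁ * c₃ := by positivity
  have a1 : 0 < c₁ + c₂ + c₃ := by positivity
  have e2 : 0 < X * (X + 4) + (X + 4) * X + X * X := by positivity
  have e1 : 0 < X + (X + 4) + X := by positivity
  have r2 : (X * (X + 4) + (X + 4) * X + X * X) * (c₁ * c₂ * c₃)
      ≤ (c₁ * c₂ + c₂ * c₃ + c₁ * c₃) * (X * (X + 4) * X) := by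
    rw [hc₁Z, hc₂Z, hc₃Z]; exact esymm_two_mul_le ht0.le hZ4 hZX.le
  have r1 : (X + (X + 4) + X) * (c₁ * c₂ + c₂ * c₃ + c₁ * c₃)
      ≤ (c₁ + c₂ + c₃) * (X * (X + 4) + (X + 4) * X + X * X) := by
    rw [hc₁Z, hc₂Z, hc₃Z]; exact esymm_one_mul_le ht0.le hZ4 hZX.le
  have hp0 : 0 < p := by linarith
  have hE2 : X * (X + 4) + (X + 4) * X + X * X < p * (c₁ * c₂ + c₂ * c₃ + c₁ * c₃) := by
    have := mul_lt_mul_of_pos_left hE3 e2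
    have := mul_le_mul_of_nonneg_left r2 hp0.le
    refine lt_of_mul_lt_mul_right (a := X * (X + 4) * X) ?_ e3.le
    linarith
  have hE1 : X + (X + 4) + X < p * (c₁ + c₂ + c₃) := by
    have := mul_lt_mul_of_pos_left hE2 e1
    have := mul_le_mul_of_nonneg_left r1 hp0.le
    refine lt_of_mul_lt_mul_right (a := X * (X + 4) + (X + 4) * X + X * X) ?_ e2.le
    linarith
  have key : ∀ {x y : ℝ}, 0 < y → x < p * y → x / (p * y) < 1 := fun hy h => by
    rw [div_lt_one (by positivity)]; exact h
  -- `κ` is the largest of the four ratios that have to be dominated; each of them is below 1.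
  refine ⟨max (max (1 / (p * 1)) ((X + (X + 4) + X) / (p * (c₁ + c₂ + c₃))))
    (max ((X * (X + 4) + (X + 4) * X + X * X) / (p * (c₁ * c₂ + c₂ * c₃ + c₁ * c₃)))
      (X * (X + 4) * X / (p * (c₁ * c₂ * c₃)))), ?_, ?_, ?_, ?_, ?_, ?_⟩
  · exact lt_max_of_lt_left (lt_max_of_lt_left (by positivity))
  · exact max_lt (max_lt (key (x := 1) (y := 1) one_pos (by linarith)) (key a1 hE1))
      (max_lt (key a2 hE2) (key a3 hE3))
  · rw [← div_le_iff₀ hp0]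
    exact le_max_of_le_left (le_max_of_le_left (by rw [mul_one]))
  all_goals rw [mul_assoc (max _ _) p, ← div_le_iff₀ (by positivity)]
  · exact le_max_of_le_left (le_max_right _ _)
  · exact le_max_of_le_right (le_max_left _ _)
  · exact le_max_of_le_right (le_max_right _ _)

/-! ### Angular calculus on homogeneous functions of degree zero -/

variable {n : ℕ}

/-- The partial derivative `∂ᵢ f`. -/
def pd (i : Fin n) (f : E n → ℝ) : E n → ℝ :=
  fun x => fderiv ℝ f x (EuclideanSpace.single i 1)

theorem contDiff_pd {f : E n → ℝ} (hf : ContDiff ℝ ∞ f) (i : Fin n) : ContDiff ℝ ∞ (pd i f) :=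
  (hf.fderiv_right (m := ∞) (by simp)).clm_apply contDiff_const

theorem pd_pd {f : E n → ℝ} {x : E n} (hf : ContDiffAt ℝ 2 f x) (i j : Fin n) :
    pd i (pd j f) x = iteratedFDeriv ℝ 2 f x
      ![EuclideanSpace.single i 1, EuclideanSpace.single j 1] := by
  have h : DifferentiableAt ℝ (fderiv ℝ f) x :=
    (hf.fderiv_right (m := 1) (by norm_num)).differentiableAt (by norm_num)
  rw [iteratedFDeriv_two_apply]
  unfold pd
  rw [fderiv_clm_apply h (differentiableAt_const _)]
  simp

theorem laplacian_eq_sum_pd {f : E n → ℝ} (hf : ContDiff ℝ ∞ f) :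
    Δ f = fun x => ∑ i, pd i (pd i f) x := by
  rw [InnerProductSpace.laplacian_eq_iteratedFDeriv_orthonormalBasis f
    (EuclideanSpace.basisFun (Fin n) ℝ)]
  ext x
  refine Finset.sum_congr rfl fun i _ => ?_
  rw [pd_pd (hf.contDiffAt.of_le (by norm_cast))]
  simp

/-- Functions on `ℝⁿ` that vanish at the origin, are smooth elsewhere, and are homogeneous of
degree zero. -/
def HomZero (n : ℕ) : NonUnitalSubalgebra ℝ (E n → ℝ) where
  carrier := {q | ContDiffOn ℝ ∞ q {0}ᶜ ∧ (∀ c : ℝ, 0 < c → ∀ x, q (c • x) = q x) ∧ q 0 = 0}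
  zero_mem' := ⟨contDiffOn_const, by simp, rfl⟩
  add_mem' := fun ⟨h1, h2, h3⟩ ⟨h4, h5, h6⟩ =>
    ⟨h1.add h4, fun c hc x => by simp [h2 c hc, h5 c hc], by simp [h3, h6]⟩
  mul_mem' := fun ⟨h1, h2, h3⟩ ⟨h4, h5, h6⟩ =>
    ⟨h1.mul h4, fun c hc x => by simp [h2 c hc, h5 c hc], by simp [h3]⟩
  smul_mem' := fun r _ ⟨h1, h2, h3⟩ =>
    ⟨contDiffOn_const.smul h1, fun c hc x => by simp [h2 c hc], by simp [h3]⟩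

namespace HomZero

theorem contDiffAt (q : HomZero n) {x : E n} (hx : x ≠ 0) : ContDiffAt ℝ ∞ q.1 x :=
  q.2.1.contDiffAt (isOpen_compl_singleton.mem_nhds hx)

theorem differentiableAt (q : HomZero n) {x : E n} (hx : x ≠ 0) : DifferentiableAt ℝ q.1 x :=
  (HomZero.contDiffAt q hx).differentiableAt (by simp)

theorem apply_smul (q : HomZero n) {c : ℝ} (hc : 0 < c) (x : E n) : q.1 (c • x) = q.1 x :=
  q.2.2.1 c hc x

theorem apply_zero (q : HomZero n) : q.1 0 = 0 := q.2.2.2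

theorem continuousOn (q : HomZero n) : ContinuousOn q.1 {0}ᶜ := q.2.1.continuousOn

theorem fderiv_smul (q : HomZero n) {c : ℝ} (hc : 0 < c) (x : E n) :
    fderiv ℝ q.1 (c • x) = c⁻¹ • fderiv ℝ q.1 x := by
  have h : (fun y => q.1 (c • y)) = q.1 := funext fun y => HomZero.apply_smul q hc y
  have := fderiv_comp_smul (𝕜 := ℝ) (f := q.1) (x := x) (c := c)
  rw [h] at this
  rw [this, smul_smul, inv_mul_cancel₀ hc.ne', one_smul]

theorem fderiv_apply_self (q : HomZero n) (x : E n) : fderiv ℝ q.1 x x = 0 := by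
  rcases eq_or_ne x 0 with rfl | hx
  · simp
  have h1 : HasDerivAt (fun t : ℝ => q.1 (t • x)) (fderiv ℝ q.1 x x) 1 := by
    have h2 : HasFDerivAt q.1 (fderiv ℝ q.1 x) ((1 : ℝ) • x) := by
      rw [one_smul]; exact (HomZero.differentiableAt q hx).hasFDerivAt
    have h3 : HasDerivAt (fun t : ℝ => t • x) x 1 := by
      simpa using (hasDerivAt_id (1 : ℝ)).smul_const x
    exact h2.comp_hasDerivAt 1 h3
  have h4 : (fun t : ℝ => q.1 (t • x)) =ᶠ[nhds 1] fun _ => q.1 x := by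
    filter_upwards [lt_mem_nhds one_pos] with t ht using HomZero.apply_smul q ht x
  exact h1.unique ((hasDerivAt_const (1 : ℝ) (q.1 x)).congr_of_eventuallyEq h4)

/-- The unit of `HomZero n`: the function `1` away from the origin. -/
def unit (n : ℕ) : HomZero n := ⟨fun x => if x = 0 then 0 else 1, by
  refine ⟨(contDiffOn_const (c := (1 : ℝ))).congr fun x hx => if_neg hx, fun c hc x => ?_, if_pos rfl⟩
  simp [hc.ne']⟩

theorem unit_apply {x : E n} (hx : x ≠ 0) : (unit n).1 x = 1 := if_neg hx

theorem unit_mul (q : HomZero n) : unit n * q = q := by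
  ext x
  rcases eq_or_ne x 0 with rfl | hx
  · simp [apply_zero]
  · simp [unit_apply hx]

/-- The coordinate functions `xᵢ / ‖x‖`. -/
def coord (i : Fin n) : HomZero n := ⟨fun x => x i / ‖x‖, by
  refine ⟨?_, fun c hc x => ?_, by simp⟩
  · refine ContDiffOn.div (by fun_prop) (fun x hx => (contDiffAt_norm ℝ hx).contDiffWithinAt)
      fun x hx => norm_ne_zero_iff.mpr hx
  · simp [norm_smul, abs_of_pos hc, mul_div_mul_left _ _ hc.ne']⟩

theorem coord_apply (i : Fin n) (x : E n) : (coord i).1 x = x i / ‖x‖ := rfl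

theorem sum_coord_mul_self : ∑ i, coord i * coord i = unit n := by
  ext x
  rcases eq_or_ne x 0 with rfl | hx
  · simp [apply_zero]
  · have : ∑ i, (x i) ^ 2 = ‖x‖ ^ 2 := by simp [EuclideanSpace.norm_sq_eq]
    have hx' : ‖x‖ ≠ 0 := norm_ne_zero_iff.mpr hx
    simp only [AddSubmonoidClass.coe_finsetSum, Finset.sum_apply, unit_apply hx,
      MulMemClass.coe_mul, Pi.mul_apply, coord_apply]
    rw [eq_comm, ← div_self (pow_ne_zero 2 hx')]
    nth_rw 1 [← this]
    rw [Finset.sum_div]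
    exact Finset.sum_congr rfl fun i _ => by field_simp

/-- The angular derivative `‖x‖ ∂ᵢ`. -/
def ang (i : Fin n) : HomZero n →ₗ[ℝ] HomZero n where
  toFun q := ⟨fun x => ‖x‖ * pd i q.1 x, by
    refine ⟨?_, fun c hc x => ?_, by simp⟩
    · refine ContDiffOn.mul (fun x hx => (contDiffAt_norm ℝ hx).contDiffWithinAt) ?_
      exact (q.2.1.fderiv_of_isOpen (m := ∞) isOpen_compl_singleton (by simp)).clm_apply
        contDiffOn_const
    · simp only [pd, HomZero.fderiv_smul q hc, norm_smul, Real.norm_eq_abs, abs_of_pos hc]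
      simp only [_root_.smul_apply, smul_eq_mul]
      field_simp⟩
  map_add' q q' := by
    ext x
    rcases eq_or_ne x 0 with rfl | hx
    · simp
    · simp [pd, fderiv_add (HomZero.differentiableAt q hx) (HomZero.differentiableAt q' hx), mul_add]
  map_smul' c q := by
    ext x
    rcases eq_or_ne x 0 with rfl | hx
    · simp
    · simp [pd, fderiv_const_smul (HomZero.differentiableAt q hx), mul_left_comm]

theorem ang_apply (i : Fin n) (q : HomZero n) (x : E n) : (ang i q).1 x = ‖x‖ * pd i q.1 x := rfl

theorem ang_mul (i : Fin n) (f g : HomZero n) : ang i (f * g) = f * ang i g + g * ang i f := by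
  ext x
  rcases eq_or_ne x 0 with rfl | hx
  · simp [apply_zero]
  · have := fderiv_mul (HomZero.differentiableAt f hx) (HomZero.differentiableAt g hx)
    simp [ang_apply, pd, this]
    ring

/-- Euler's identity. It removes the first-order remainder, so that `∑ (‖x‖ ∂ᵢ)²` is `‖x‖² Δ` on
degree-zero functions. -/
theorem sum_coord_mul_ang (q : HomZero n) : ∑ i, coord i * ang i q = 0 := by
  ext x
  rcases eq_or_ne x 0 with rfl | hx
  · simp [apply_zero]
  · have hx' : ‖x‖ ≠ 0 := norm_ne_zero_iff.mpr hx
    have h : x = ∑ i, x i • EuclideanSpace.single i (1 : ℝ) := by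
      ext j; simp [Pi.single_apply]
    have h0 := HomZero.fderiv_apply_self q x
    nth_rw 2 [h] at h0
    rw [map_sum] at h0
    simp only [map_smul, smul_eq_mul] at h0
    simp only [AddSubmonoidClass.coe_finsetSum, Finset.sum_apply, MulMemClass.coe_mul,
      Pi.mul_apply, coord_apply, ang_apply, ZeroMemClass.coe_zero, Pi.zero_apply, pd]
    rw [← h0]
    exact Finset.sum_congr rfl fun i _ => by field_simp

theorem fderiv_norm_single {x : E n} (hx : x ≠ 0) (i : Fin n) :
    fderiv ℝ (fun y : E n => ‖y‖) x (EuclideanSpace.single i 1) = x i / ‖x‖ := by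
  have h := ((hasStrictFDerivAt_norm_sq x).hasFDerivAt.sqrt
    (pow_ne_zero 2 (norm_ne_zero_iff.mpr hx))).fderiv
  simp only [Real.sqrt_sq (norm_nonneg _)] at h
  rw [h]
  have hx' : ‖x‖ ≠ 0 := norm_ne_zero_iff.mpr hx
  simp [EuclideanSpace.inner_single_right]
  field_simp

theorem ang_coord (i j : Fin n) :
    ang i (coord j) = (if i = j then unit n else 0) - coord i * coord j := by
  ext x
  rcases eq_or_ne x 0 with rfl | hx
  · split_ifs <;> simp [apply_zero]
  · have hx' : ‖x‖ ≠ 0 := norm_ne_zero_iff.mpr hx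
    have h1 : DifferentiableAt ℝ (fun y : E n => y j) x := by fun_prop
    have h2 : DifferentiableAt ℝ (fun y : E n => ‖y‖⁻¹) x :=
      ((contDiffAt_norm ℝ hx).differentiableAt (n := ∞) (by simp)).inv hx'
    have h3 : fderiv ℝ (fun y : E n => y j) x (EuclideanSpace.single i 1)
        = if i = j then 1 else 0 := by
      have : (fun y : E n => y j) = EuclideanSpace.proj (𝕜 := ℝ) j := rfl
      rw [this, ContinuousLinearMap.fderiv]
      simp [eq_comm]
    have h4 : fderiv ℝ (fun y : E n => ‖y‖⁻¹) x (EuclideanSpace.single i 1)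
        = -(x i / ‖x‖) / ‖x‖ ^ 2 := by
      have := ((hasDerivAt_inv hx').comp_hasFDerivAt x
        ((contDiffAt_norm ℝ hx).differentiableAt (n := ∞) (by simp)).hasFDerivAt).fderiv
      rw [Function.comp_def] at this
      rw [this]
      simp [fderiv_norm_single hx]
      field_simp
    have h5 : (coord j).1 = fun y : E n => y j * ‖y‖⁻¹ := rfl
    rw [ang_apply, pd, h5, fderiv_fun_mul h1 h2]
    simp only [_root_.add_apply, _root_.smul_apply, smul_eq_mul, h3, h4]
    split_ifs
    · simp [unit_apply hx, coord_apply]; field_simp; ring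
    · simp [coord_apply]; field_simp

/-- The Laplace–Beltrami operator of the sphere, on homogeneous functions of degree zero. -/
def lap : HomZero n →ₗ[ℝ] HomZero n := ∑ i, ang i ∘ₗ ang i

theorem lap_apply (q : HomZero n) : lap q = ∑ i, ang i (ang i q) := by simp [lap]

theorem ang_unit (i : Fin n) : ang i (unit n) = 0 := by
  have h := ang_mul i (unit n) (unit n)
  rw [unit_mul, unit_mul] at h
  simpa using h

theorem lap_mul (f g : HomZero n) :
    lap (f * g) = f * lap g + g * lap f + (2 : ℝ) • ∑ i, ang i f * ang i g := by
  simp only [lap_apply, ang_mul, map_add, Finset.mul_sum, Finset.smul_sum,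
    ← Finset.sum_add_distrib]
  refine Finset.sum_congr rfl fun i _ => ?_
  ext x
  simp
  ring

end HomZero

/-! ### Separated functions and their Laplacian -/

/-- Smooth compactly supported functions on the line. -/
def Profile : Submodule ℝ (ℝ → ℝ) where
  carrier := {η | ContDiff ℝ ∞ η ∧ HasCompactSupport η}
  zero_mem' := ⟨contDiff_const, HasCompactSupport.zero⟩
  add_mem' := fun ⟨h1, h2⟩ ⟨h3, h4⟩ => ⟨h1.add h3, h2.add h4⟩
  smul_mem' := fun r _ ⟨h1, h2⟩ => ⟨contDiff_const.smul h1, h2.smul_left (f := fun _ => r)⟩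

namespace Profile

theorem contDiff (η : Profile) : ContDiff ℝ ∞ η.1 := η.2.1

theorem differentiable (η : Profile) : Differentiable ℝ η.1 := (contDiff η).differentiable (by simp)

theorem hasCompactSupport (η : Profile) : HasCompactSupport η.1 := η.2.2

theorem continuous (η : Profile) : Continuous η.1 := (contDiff η).continuous

theorem integrable (η : Profile) : Integrable η.1 :=
  (continuous η).integrable_of_hasCompactSupport (hasCompactSupport η)

/-- Differentiation of profiles. -/
def der : Module.End ℝ Profile where
  toFun η := ⟨deriv η.1, (contDiff η).deriv' , (hasCompactSupport η).deriv⟩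
  map_add' η ζ := by
    ext s
    exact deriv_add (differentiable η s) (differentiable ζ s)
  map_smul' c η := by
    ext s
    exact deriv_const_smul c (differentiable η s)

theorem der_apply (η : Profile) (s : ℝ) : (der η).1 s = deriv η.1 s := rfl

theorem integral_der (η : Profile) : ∫ s, (der η).1 s = 0 :=
  integral_eq_zero_of_hasDerivAt_of_integrable
    (fun s => (differentiable η s).hasDerivAt) (integrable (der η)) (integrable η)

end Profile

/-- The function `‖x‖ᵃ η(log ‖x‖) q(x)`. -/
def sep (a : ℝ) (η : Profile) (q : HomZero n) : E n → ℝ :=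
  fun x => ‖x‖ ^ a * η.1 (Real.log ‖x‖) * q.1 x

theorem sep_apply (a : ℝ) (η : Profile) (q : HomZero n) (x : E n) :
    sep a η q x = ‖x‖ ^ a * η.1 (Real.log ‖x‖) * q.1 x := rfl

theorem sep_apply_zero (a : ℝ) (η : Profile) (q : HomZero n) : sep a η q 0 = 0 := by
  simp [sep_apply, HomZero.apply_zero]

theorem sep_add_left (a : ℝ) (η ζ : Profile) (q : HomZero n) :
    sep a (η + ζ) q = sep a η q + sep a ζ q := by
  ext x; simp [sep_apply]; ring

theorem sep_sum_right (a : ℝ) (η : Profile) {ι : Type*} (s : Finset ι) (q : ι → HomZero n) :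
    sep a η (∑ i ∈ s, q i) = ∑ i ∈ s, sep a η (q i) := by
  ext x; simp [sep_apply, Finset.mul_sum]

/-- The compact shell that carries `sep a η q`. -/
def shell (n : ℕ) (η : Profile) : Set (E n) := {x | ‖x‖ ∈ Real.exp '' tsupport η.1}

theorem isCompact_shell (η : Profile) : IsCompact (shell n η) := by
  have hK : IsCompact (Real.exp '' tsupport η.1) :=
    (Profile.hasCompactSupport η).isCompact.image Real.continuous_exp
  refine Metric.isCompact_of_isClosed_isBounded (hK.isClosed.preimage continuous_norm) ?_
  obtain ⟨R, hR⟩ := hK.isBounded.subset_closedBall 0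
  refine (Metric.isBounded_closedBall (x := (0 : E n)) (r := R)).subset fun x hx => ?_
  have := hR hx
  simpa using this

theorem shell_subset (η : Profile) : shell n η ⊆ {0}ᶜ := by
  rintro x ⟨s, -, hs⟩ (rfl : x = 0)
  rw [norm_zero] at hs
  exact (Real.exp_pos s).ne' hs

theorem profile_eq_zero_of_notMem_shell {η : Profile} {x : E n} (h0 : x ≠ 0)
    (hx : x ∉ shell n η) : η.1 (Real.log ‖x‖) = 0 := by
  by_contra h
  exact hx ⟨_, subset_tsupport _ h, Real.exp_log (norm_pos_iff.mpr h0)⟩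

theorem tsupport_sep_subset (a : ℝ) (η : Profile) (q : HomZero n) :
    tsupport (sep a η q) ⊆ shell n η := by
  refine closure_minimal (fun x hx => ?_) (isCompact_shell η).isClosed
  by_contra h
  rcases eq_or_ne x 0 with rfl | h0
  · exact hx (sep_apply_zero a η q)
  · exact hx (by simp [sep_apply, profile_eq_zero_of_notMem_shell h0 h])

theorem contDiff_sep (a : ℝ) (η : Profile) (q : HomZero n) : ContDiff ℝ ∞ (sep a η q) := by
  rw [contDiff_iff_contDiffAt]
  intro x
  rcases eq_or_ne x 0 with rfl | h0
  · have : sep a η q =ᶠ[nhds 0] fun _ => 0 := by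
      have h := (isCompact_shell (n := n) η).isClosed.isOpen_compl.mem_nhds
        (fun h => shell_subset η h rfl : (0 : E n) ∉ shell n η)
      filter_upwards [h] with y hy
      exact image_eq_zero_of_notMem_tsupport fun h => hy (tsupport_sep_subset a η q h)
    exact contDiffAt_const.congr_of_eventuallyEq this
  · have h1 : ContDiffAt ℝ ∞ (fun y : E n => ‖y‖) x := contDiffAt_norm ℝ h0
    have h2 : ‖x‖ ≠ 0 := norm_ne_zero_iff.mpr h0
    exact ((h1.rpow_const_of_ne h2).mul
      ((Profile.contDiff η).contDiffAt.comp x (h1.log h2))).mul (HomZero.contDiffAt q h0)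

theorem isTestFunction_sep (a : ℝ) (η : Profile) (q : HomZero n) :
    IsTestFunction {0}ᶜ (sep a η q) :=
  ⟨contDiff_sep a η q, (isCompact_shell η).of_isClosed_subset (isClosed_tsupport _)
    (tsupport_sep_subset a η q), (tsupport_sep_subset a η q).trans (shell_subset η)⟩

/-- In the variable `s = log r`, `∂ᵣ (r^a η(s)) = r^(a-1) (a η + η')(s)`. Sums of separated
functions are thus closed under differentiation. -/
theorem pd_sep (a : ℝ) (η : Profile) (q : HomZero n) (i : Fin n) :
    pd i (sep a η q) = sep (a - 1) (a • η + Profile.der η) (HomZero.coord i * q)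
      + sep (a - 1) η (HomZero.ang i q) := by
  ext x
  rcases eq_or_ne x 0 with rfl | h0
  · have h : (0 : E n) ∉ tsupport (fderiv ℝ (sep a η q)) := fun h =>
      shell_subset η (tsupport_sep_subset a η q (tsupport_fderiv_subset ℝ h)) rfl
    simp [pd, image_eq_zero_of_notMem_tsupport h, sep_apply_zero]
  · have hr : 0 < ‖x‖ := norm_pos_iff.mpr h0
    have hn : HasFDerivAt (fun y : E n => ‖y‖) (fderiv ℝ (fun y : E n => ‖y‖) x) x :=
      ((contDiffAt_norm ℝ h0).differentiableAt (n := ∞) (by simp)).hasFDerivAt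
    have h1 : HasDerivAt (fun r : ℝ => r ^ a * η.1 (Real.log r))
        (‖x‖ ^ (a - 1) * (a • η + Profile.der η).1 (Real.log ‖x‖)) ‖x‖ := by
      have h2 := (Real.hasDerivAt_rpow_const (x := ‖x‖) (p := a) (Or.inl hr.ne')).mul
        (((Profile.differentiable η (Real.log ‖x‖)).hasDerivAt).comp ‖x‖
          (Real.hasDerivAt_log hr.ne'))
      refine h2.congr_deriv ?_
      simp only [Submodule.coe_add, Submodule.coe_smul, Pi.add_apply, Pi.smul_apply,
        Profile.der_apply, smul_eq_mul, Function.comp_apply]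
      rw [Real.rpow_sub_one hr.ne']
      field_simp
    have h3 := ((h1.comp_hasFDerivAt x hn).mul (HomZero.differentiableAt q h0).hasFDerivAt).fderiv
    have h4 : (sep a η q) = ((fun r : ℝ => r ^ a * η.1 (Real.log r)) ∘ fun y : E n => ‖y‖) * q.1 :=
      rfl
    rw [pd, h4, h3]
    simp only [_root_.add_apply, _root_.smul_apply, smul_eq_mul, HomZero.fderiv_norm_single h0,
      Pi.add_apply, sep_apply, HomZero.ang_apply, MulMemClass.coe_mul, Pi.mul_apply,
      HomZero.coord_apply, Function.comp_apply]
    rw [Real.rpow_sub_one hr.ne']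
    simp only [pd]
    field_simp
    ring

/-- The radial part of the Laplacian acting on `‖x‖ᵃ η(log ‖x‖)`. -/
def radial (n : ℕ) (a : ℝ) : Polynomial ℝ :=
  (Polynomial.X + Polynomial.C a) * (Polynomial.X + Polynomial.C (a + n - 2))

/-- With `D = d/ds`, the radial operator is `(D + a)(D + a - 1) + (n - 1)(D + a) = (D + a)(D + a + n
- 2)`; the mixed radial-angular terms cancel by Euler's identity. -/
theorem laplacian_sep (a : ℝ) (η : Profile) (q : HomZero n) :
    Δ (sep a η q) = sep (a - 2) (Polynomial.aeval Profile.der (radial n a) η) q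
      + sep (a - 2) η (HomZero.lap q) := by
  rw [laplacian_eq_sum_pd (contDiff_sep a η q)]
  have hpd : ∀ (i : Fin n) (f g : E n → ℝ), ContDiff ℝ ∞ f → ContDiff ℝ ∞ g →
      pd i (f + g) = pd i f + pd i g := fun i f g hf hg => by
    ext x
    simp [pd, fderiv_add (hf.differentiable (by simp) x) (hg.differentiable (by simp) x)]
  ext x
  have key : ∀ i, pd i (pd i (sep a η q)) x
      = sep (a - 2) ((a - 1) • (a • η + Profile.der η) + Profile.der (a • η + Profile.der η))
          (HomZero.coord i * HomZero.coord i * q) x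
        + sep (a - 2) (a • η + Profile.der η) ((HomZero.unit n - HomZero.coord i * HomZero.coord i)
            * q + HomZero.coord i * HomZero.ang i q) x
        + (sep (a - 2) ((a - 1) • η + Profile.der η) (HomZero.coord i * HomZero.ang i q) x
        + sep (a - 2) η (HomZero.ang i (HomZero.ang i q)) x) := by
    intro i
    rw [pd_sep, hpd _ _ _ (contDiff_sep _ _ _) (contDiff_sep _ _ _), pd_sep, pd_sep,
      HomZero.ang_mul, HomZero.ang_coord, if_pos rfl, mul_assoc]
    rw [show a - 1 - 1 = a - 2 by ring]
    simp only [Pi.add_apply, mul_comm q, add_comm (HomZero.coord i * HomZero.ang i q)]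
  simp only [key, Finset.sum_add_distrib]
  have e1 : ∀ (b : ℝ) (ζ : Profile) (f : Fin n → HomZero n),
      ∑ i, sep b ζ (f i) x = sep b ζ (∑ i, f i) x := fun b ζ f => by
    rw [sep_sum_right, Finset.sum_apply]
  have e2 : ∑ i, HomZero.coord i * HomZero.coord i * q = q := by
    rw [← Finset.sum_mul, HomZero.sum_coord_mul_self, HomZero.unit_mul]
  have e3 : ∑ i, ((HomZero.unit n - HomZero.coord i * HomZero.coord i) * q
      + HomZero.coord i * HomZero.ang i q) = ((n : ℝ) - 1) • q := by
    rw [Finset.sum_add_distrib, HomZero.sum_coord_mul_ang, ← Finset.sum_mul,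
      Finset.sum_sub_distrib, HomZero.sum_coord_mul_self, Finset.sum_const, add_zero, sub_mul,
      HomZero.unit_mul, Finset.card_univ, Fintype.card_fin, smul_mul_assoc, HomZero.unit_mul,
      sub_smul, one_smul, Nat.cast_smul_eq_nsmul]
  rw [e1, e1, e1, e1, e2, e3, HomZero.sum_coord_mul_ang, ← HomZero.lap_apply]
  simp only [radial, map_mul, map_add, Polynomial.aeval_X, Polynomial.aeval_C, Module.End.mul_apply,
    LinearMap.add_apply, Module.algebraMap_end_apply, Pi.add_apply, sep_apply, Submodule.coe_add,
    Pi.smul_apply, smul_eq_mul, map_smul, ZeroMemClass.coe_zero, Pi.zero_apply,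
    SetLike.val_smul]
  ring

/-! ### Integration in polar coordinates -/

/-- The surface measure of the unit sphere. -/
abbrev sphereMeasure (n : ℕ) : Measure (Metric.sphere (0 : E n) 1) :=
  (volume : Measure (E n)).toSphere

theorem integral_Ioi_eq_integral_log (g : ℝ → ℝ) :
    ∫ r in Set.Ioi (0 : ℝ), r⁻¹ * g (Real.log r) = ∫ s, g s := by
  have h := integral_image_eq_integral_abs_deriv_smul MeasurableSet.univ
    (fun x _ => (Real.hasDerivAt_exp x).hasDerivWithinAt) Real.exp_injective.injOn
    (fun r => r⁻¹ * g (Real.log r))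
  rw [Set.image_univ, Real.range_exp] at h
  rw [h, Measure.restrict_univ]
  refine integral_congr_ae (.of_forall fun s => ?_)
  simp [abs_of_pos (Real.exp_pos s), Real.exp_ne_zero]

/-- The power `-n` leaves `r^(-n) r^(n-1) dr = ds`, so radial and angular integrals decouple. Every
later choice of a degree `a` is made to reach total degree `-n`. -/
theorem integral_polar (hn : n ≠ 0) (g : ℝ → ℝ) (v : E n → ℝ) :
    ∫ x : E n, ‖x‖ ^ (-(n : ℝ)) * g (Real.log ‖x‖) * v (‖x‖⁻¹ • x)
      = (∫ s, g s) * ∫ θ, v θ ∂sphereMeasure n := by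
  have : Nontrivial (E n) := by
    have : Nonempty (Fin n) := ⟨⟨0, Nat.pos_of_ne_zero hn⟩⟩
    infer_instance
  have hpres := (volume : Measure (E n)).measurePreserving_homeomorphUnitSphereProd
  rw [finrank_euclideanSpace_fin] at hpres
  have h1 := hpres.integral_comp (Homeomorph.measurableEmbedding _)
    (fun y : Metric.sphere (0 : E n) 1 × Set.Ioi (0 : ℝ) =>
      v y.1 * ((y.2 : ℝ) ^ (-(n : ℝ)) * g (Real.log y.2)))
  rw [integral_prod_mul (fun θ : Metric.sphere (0 : E n) 1 => v θ)
    (fun r : Set.Ioi (0 : ℝ) => (r : ℝ) ^ (-(n : ℝ)) * g (Real.log r))] at h1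
  calc ∫ x : E n, ‖x‖ ^ (-(n : ℝ)) * g (Real.log ‖x‖) * v (‖x‖⁻¹ • x)
      = ∫ x : ({0}ᶜ : Set (E n)), ‖(x : E n)‖ ^ (-(n : ℝ)) * g (Real.log ‖(x : E n)‖)
          * v (‖(x : E n)‖⁻¹ • (x : E n))
            ∂((volume : Measure (E n)).comap Subtype.val) := by
        rw [integral_subtype_comap (measurableSet_singleton _).compl
          fun x : E n ↦ ‖x‖ ^ (-(n : ℝ)) * g (Real.log ‖x‖) * v (‖x‖⁻¹ • x),
          restrict_compl_singleton]
    _ = (∫ θ, v θ ∂sphereMeasure n) * ∫ r : Set.Ioi (0 : ℝ), (r : ℝ) ^ (-(n : ℝ))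
          * g (Real.log r) ∂(Measure.volumeIoiPow (n - 1)) := by
        rw [← h1]
        refine integral_congr_ae (.of_forall fun x => ?_)
        simp; ring
    _ = _ := by
        rw [mul_comm]
        congr 1
        simp only [Measure.volumeIoiPow, ENNReal.ofReal]
        rw [integral_withDensity_eq_integral_smul (by fun_prop),
          integral_subtype_comap measurableSet_Ioi fun a : ℝ ↦
            Real.toNNReal (a ^ (n - 1)) • (a ^ (-(n : ℝ)) * g (Real.log a)),
          ← integral_Ioi_eq_integral_log]
        refine setIntegral_congr_fun measurableSet_Ioi fun r hr => ?_
        have hr' : (0 : ℝ) < r := hr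
        simp only [NNReal.smul_def, Real.coe_toNNReal _ (pow_nonneg hr'.le (n - 1)), smul_eq_mul]
        rw [← mul_assoc, ← Real.rpow_natCast, ← Real.rpow_add hr', Nat.cast_pred
          (Nat.pos_of_ne_zero hn), ← Real.rpow_neg_one]
        ring_nf

theorem HomZero.apply_normalize (q : HomZero n) {x : E n} (hx : x ≠ 0) :
    q.1 (‖x‖⁻¹ • x) = q.1 x :=
  HomZero.apply_smul q (inv_pos.mpr (norm_pos_iff.mpr hx)) x

theorem ae_ne_zero (hn : n ≠ 0) : ∀ᵐ x : E n, x ≠ 0 := by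
  have : Nonempty (Fin n) := ⟨⟨0, Nat.pos_of_ne_zero hn⟩⟩
  exact Measure.ae_ne volume 0

theorem integral_hom_mul_sep (hn : n ≠ 0) {u v : E n → ℝ} {b : ℝ}
    (hu : ∀ᵐ x, u x = ‖x‖ ^ b * v (‖x‖⁻¹ • x)) {a : ℝ} (hab : b + a = -n)
    (η : Profile) (q : HomZero n) :
    ∫ x, u x * sep a η q x = (∫ s, η.1 s) * ∫ θ, v θ * q.1 θ ∂sphereMeasure n := by
  rw [← integral_polar hn η.1 fun x => v x * q.1 x]
  refine integral_congr_ae ?_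
  filter_upwards [hu, ae_ne_zero hn] with x hx h0
  rw [hx, sep_apply, HomZero.apply_normalize q h0, ← hab,
    Real.rpow_add (norm_pos_iff.mpr h0)]
  ring

theorem integral_sep_mul_sep (hn : n ≠ 0) {a b : ℝ} (hab : a + b = -n) (η ζ : Profile)
    (q r : HomZero n) :
    ∫ x, sep a η q x * sep b ζ r x
      = (∫ s, η.1 s * ζ.1 s) * ∫ θ, q.1 θ * r.1 θ ∂sphereMeasure n := by
  rw [← integral_polar hn (fun s => η.1 s * ζ.1 s) fun x => q.1 x * r.1 x]
  refine integral_congr_ae ?_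
  filter_upwards [ae_ne_zero hn] with x h0
  rw [sep_apply, sep_apply, HomZero.apply_normalize q h0, HomZero.apply_normalize r h0, ← hab,
    Real.rpow_add (norm_pos_iff.mpr h0)]
  ring

/-! ### Integration by parts for test functions -/

section Parts

variable {f g : E n → ℝ}

theorem integrable_mul_of_hasCompactSupport (hf : Continuous f) (hg : Continuous g)
    (hc : HasCompactSupport g) : Integrable (fun x => f x * g x) :=
  (hf.mul hg).integrable_of_hasCompactSupport hc.mul_left

theorem hasCompactSupport_pd (hf : HasCompactSupport f) (i : Fin n) :
    HasCompactSupport (pd i f) := hf.fderiv_apply ℝ _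

theorem integral_pd_mul (hf : ContDiff ℝ ∞ f) (hg : ContDiff ℝ ∞ g) (hc : HasCompactSupport g)
    (i : Fin n) : ∫ x, pd i f x * g x = -∫ x, f x * pd i g x := by
  have := integral_mul_fderiv_eq_neg_fderiv_mul_of_integrable (μ := volume) (f := f) (g := g)
    (v := EuclideanSpace.single i 1)
    (integrable_mul_of_hasCompactSupport (contDiff_pd hf i).continuous hg.continuous hc)
    (integrable_mul_of_hasCompactSupport hf.continuous (contDiff_pd hg i).continuous
      (hasCompactSupport_pd hc i))
    (integrable_mul_of_hasCompactSupport hf.continuous hg.continuous hc)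
    (fun x _ => hf.differentiable (by simp) x) (fun x _ => hg.differentiable (by simp) x)
  rw [eq_neg_iff_add_eq_zero, ← eq_neg_iff_add_eq_zero.mp this, add_comm]
  rfl

theorem contDiff_laplacian (hf : ContDiff ℝ ∞ f) : ContDiff ℝ ∞ (Δ f) := by
  rw [laplacian_eq_sum_pd hf]
  exact ContDiff.sum fun i _ => contDiff_pd (contDiff_pd hf i) i

theorem tsupport_pd_subset (f : E n → ℝ) (i : Fin n) : tsupport (pd i f) ⊆ tsupport f :=
  tsupport_fderiv_apply_subset ℝ _

theorem tsupport_laplacian_subset (hf : ContDiff ℝ ∞ f) : tsupport (Δ f) ⊆ tsupport f := by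
  rw [laplacian_eq_sum_pd hf]
  refine closure_minimal (fun x hx => ?_) (isClosed_tsupport f)
  by_contra h
  refine hx (Finset.sum_eq_zero fun i _ => image_eq_zero_of_notMem_tsupport fun h' => h ?_)
  exact tsupport_pd_subset f i (tsupport_pd_subset _ i h')

theorem IsTestFunction.pd {Ω : Set (E n)} (hf : IsTestFunction Ω f) (i : Fin n) :
    IsTestFunction Ω (pd i f) :=
  ⟨contDiff_pd hf.1 i, hasCompactSupport_pd hf.2.1 i, (tsupport_pd_subset f i).trans hf.2.2⟩

theorem IsTestFunction.laplacian {Ω : Set (E n)} (hf : IsTestFunction Ω f) :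
    IsTestFunction Ω (Δ f) :=
  ⟨contDiff_laplacian hf.1, hf.2.1.of_isClosed_subset (isClosed_tsupport _)
    (tsupport_laplacian_subset hf.1), (tsupport_laplacian_subset hf.1).trans hf.2.2⟩

theorem sum_integral_pd_mul_pd (hf : ContDiff ℝ ∞ f) (hg : ContDiff ℝ ∞ g)
    (hc : HasCompactSupport g) :
    ∑ i, ∫ x, pd i f x * pd i g x = -∫ x, f x * (Δ g) x := by
  rw [laplacian_eq_sum_pd hg]
  simp only [Finset.mul_sum]
  rw [integral_finsetSum, ← Finset.sum_neg_distrib]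
  · exact Finset.sum_congr rfl fun i _ =>
      integral_pd_mul hf (contDiff_pd hg i) (hasCompactSupport_pd hc i) i
  · exact fun i _ => integrable_mul_of_hasCompactSupport hf.continuous
      (contDiff_pd (contDiff_pd hg i) i).continuous
      (hasCompactSupport_pd (hasCompactSupport_pd hc i) i)

theorem integral_laplacian_mul (hf : ContDiff ℝ ∞ f) (hcf : HasCompactSupport f)
    (hg : ContDiff ℝ ∞ g) (hcg : HasCompactSupport g) :
    ∫ x, (Δ f) x * g x = ∫ x, f x * (Δ g) x := by
  have h1 := sum_integral_pd_mul_pd hf hg hcg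
  have h2 := sum_integral_pd_mul_pd hg hf hcf
  simp only [mul_comm (pd _ g _)] at h2
  simp only [mul_comm ((Δ f) _)]
  linarith

theorem gradient_apply (f : E n → ℝ) (x : E n) (i : Fin n) : (gradient f x) i = pd i f x := by
  rw [pd, ← inner_gradient_left, EuclideanSpace.inner_single_right]
  simp

theorem norm_gradient_sq (f : E n → ℝ) (x : E n) :
    ‖gradient f x‖ ^ 2 = ∑ i, pd i f x * pd i f x := by
  rw [EuclideanSpace.norm_sq_eq]
  refine Finset.sum_congr rfl fun i _ => ?_
  rw [gradient_apply, Real.norm_eq_abs, sq_abs, sq]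

theorem integral_norm_gradient_laplacian_sq (hf : ContDiff ℝ ∞ f) (hc : HasCompactSupport f) :
    ∫ x, ‖gradient (Δ f) x‖ ^ 2 = -∫ x, f x * (Δ (Δ (Δ f))) x := by
  have ht : IsTestFunction Set.univ f := ⟨hf, hc, Set.subset_univ _⟩
  have h1 := ht.laplacian
  have h2 := h1.laplacian
  simp only [norm_gradient_sq]
  rw [integral_finsetSum, sum_integral_pd_mul_pd h1.1 h1.1 h1.2.1,
    integral_laplacian_mul hf hc h2.1 h2.2.1]
  exact fun i _ => integrable_mul_of_hasCompactSupport (contDiff_pd h1.1 i).continuous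
    (contDiff_pd h1.1 i).continuous (hasCompactSupport_pd h1.2.1 i)

end Parts

/-! ### The spherical Laplacian on the sphere -/

theorem HomZero.continuous_sphere (q : HomZero n) :
    Continuous fun θ : Metric.sphere (0 : E n) 1 => q.1 θ :=
  (HomZero.continuousOn q).comp_continuous continuous_subtype_val fun θ => by
    simpa using ne_zero_of_mem_unit_sphere θ

theorem integrable_sphere_of_continuous {f : Metric.sphere (0 : E n) 1 → ℝ} (hf : Continuous f) :
    Integrable f (sphereMeasure n) :=
  hf.integrable_of_hasCompactSupport (HasCompactSupport.of_compactSpace f)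

/-- The `L²` inner product of the sphere. -/
def HomZero.ip (q r : HomZero n) : ℝ := ∫ θ, q.1 θ * r.1 θ ∂sphereMeasure n

theorem exists_profile : ∃ η : Profile, 0 < ∫ s, η.1 s * η.1 s := by
  let b : ContDiffBump (0 : ℝ) := default
  refine ⟨⟨b, b.contDiff, b.hasCompactSupport⟩, ?_⟩
  refine (b.continuous.mul b.continuous).integral_pos_of_hasCompactSupport_nonneg_nonzero
    (b.hasCompactSupport.mul_left) (fun x => mul_self_nonneg _) (x := 0) ?_
  simp [b.one_of_mem_closedBall (Metric.mem_closedBall_self b.rIn_pos.le)]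

/-- Inherited from the symmetry of the Euclidean Laplacian on separated functions of degree `1 -
n/2`, for which the total degree is `-n`; the radial contributions on the two sides agree and
cancel. -/
theorem HomZero.ip_lap_left (hn : n ≠ 0) (q r : HomZero n) : ip (lap q) r = ip q (lap r) := by
  obtain ⟨η, hη⟩ := exists_profile
  obtain ⟨a, ha⟩ : ∃ a : ℝ, a = 1 - n / 2 := ⟨_, rfl⟩
  have ha1 : a - 2 + a = -n := by rw [ha]; ring
  have ha2 : a + (a - 2) = -n := by rw [ha]; ring
  have hq := isTestFunction_sep a η q
  have hr := isTestFunction_sep a η r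
  have h := integral_laplacian_mul hq.1 hq.2.1 hr.1 hr.2.1
  rw [laplacian_sep, laplacian_sep] at h
  simp only [Pi.add_apply, add_mul, mul_add] at h
  rw [integral_add, integral_add, integral_sep_mul_sep hn ha1, integral_sep_mul_sep hn ha1,
    integral_sep_mul_sep hn ha2, integral_sep_mul_sep hn ha2] at h
  · simp only [mul_comm ((Polynomial.aeval Profile.der (radial n a) η).1 _)] at h
    exact mul_left_cancel₀ hη.ne' (add_left_cancel h)
  all_goals
    exact integrable_mul_of_hasCompactSupport (contDiff_sep _ _ _).continuous
      (contDiff_sep _ _ _).continuous (isTestFunction_sep _ _ _).2.1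

theorem HomZero.ip_self_nonneg (q : HomZero n) : 0 ≤ ip q q :=
  integral_nonneg fun _ => mul_self_nonneg _

/-- `L(q²)` integrates to zero, and the product rule writes it as `2 q L q + 2 |∇q|²`. -/
theorem HomZero.ip_lap_nonpos (hn : n ≠ 0) (q : HomZero n) : ip q (lap q) ≤ 0 := by
  have h1 : ip (lap (q * q)) (unit n) = 0 := by
    rw [ip_lap_left hn, lap_apply]
    simp [ang_unit, ip]
  have h2 : ip (lap (q * q)) (unit n)
      = 2 * ip q (lap q) + 2 * ∫ θ, ∑ i, (ang i q).1 θ * (ang i q).1 θ ∂sphereMeasure n := by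
    rw [ip, ip, ← integral_const_mul, ← integral_const_mul, ← integral_add]
    · refine integral_congr_ae (.of_forall fun θ => ?_)
      have : (θ : E n) ≠ 0 := ne_zero_of_mem_unit_sphere θ
      simp [lap_mul, unit_apply this]
      ring
    · exact integrable_sphere_of_continuous
        (continuous_const.mul ((continuous_sphere q).mul (continuous_sphere (lap q))))
    · exact integrable_sphere_of_continuous (continuous_const.mul (continuous_finsetSum _
        fun i _ => (continuous_sphere (ang i q)).mul (continuous_sphere (ang i q))))
  have h3 : 0 ≤ ∫ θ, ∑ i, (ang i q).1 θ * (ang i q).1 θ ∂sphereMeasure n :=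
    integral_nonneg fun _ => Finset.sum_nonneg fun _ _ => mul_self_nonneg _
  linarith

theorem pd_comm {f : E n → ℝ} (hf : ContDiff ℝ ∞ f) (i j : Fin n) :
    pd i (pd j f) = pd j (pd i f) := by
  ext x
  have h2 : ContDiffAt ℝ 2 f x := hf.contDiffAt.of_le (by norm_cast)
  have hs : IsSymmSndFDerivAt ℝ f x := h2.isSymmSndFDerivAt (by simp)
  rw [pd_pd h2, pd_pd h2, iteratedFDeriv_two_apply, iteratedFDeriv_two_apply]
  exact hs _ _

theorem pd_laplacian {f : E n → ℝ} (hf : ContDiff ℝ ∞ f) (i : Fin n) :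
    pd i (Δ f) = Δ (pd i f) := by
  rw [laplacian_eq_sum_pd hf, laplacian_eq_sum_pd (contDiff_pd hf i)]
  ext x
  have h : ∀ j ∈ Finset.univ, DifferentiableAt ℝ (pd j (pd j f)) x := fun j _ =>
    (contDiff_pd (contDiff_pd hf j) j).differentiable (by simp) x
  have h' := fderiv_fun_sum (𝕜 := ℝ) h
  change fderiv ℝ (fun x => ∑ j, pd j (pd j f) x) x (EuclideanSpace.single i 1) = _
  rw [h', _root_.sum_apply]
  refine Finset.sum_congr rfl fun j _ => ?_
  change pd i (pd j (pd j f)) x = _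
  rw [pd_comm (contDiff_pd hf j), pd_comm hf i j]

theorem laplacian_add {f g : E n → ℝ} (hf : ContDiff ℝ ∞ f) (hg : ContDiff ℝ ∞ g) :
    Δ (f + g) = Δ f + Δ g := by
  ext x
  exact ContDiffAt.laplacian_add (hf.contDiffAt.of_le (by norm_cast))
    (hg.contDiffAt.of_le (by norm_cast))

/-! ### Integrability against test functions -/

section Integrability

variable {F : Type*} [NormedAddCommGroup F] {Ω : Set (E n)} {φ : E n → ℝ}

theorem MemL2Loc.integrableOn {f : E n → F} (hf : MemL2Loc Ω f) {K : Set (E n)}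
    (hK : IsCompact K) (hKΩ : K ⊆ Ω) : IntegrableOn f K := by
  have : IsFiniteMeasure (volume.restrict K) := ⟨by simpa using hK.measure_lt_top⟩
  exact (hf K hK hKΩ).integrable (by norm_num)

theorem MemL2Loc.integrable_smul [NormedSpace ℝ F] {f : E n → F} (hf : MemL2Loc Ω f)
    (hφ : IsTestFunction Ω φ) : Integrable (fun x => φ x • f x) := by
  have h := (hf.integrableOn hφ.2.1 hφ.2.2).continuousOn_smul hφ.1.continuous.continuousOn hφ.2.1
  refine (integrableOn_iff_integrable_of_support_subset fun x hx => ?_).mp h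
  by_contra hx'
  exact hx (by simp [image_eq_zero_of_notMem_tsupport hx'])

theorem MemL2Loc.integrable_mul {f : E n → ℝ} (hf : MemL2Loc Ω f) (hφ : IsTestFunction Ω φ) :
    Integrable (fun x => f x * φ x) := by
  simpa [mul_comm] using hf.integrable_smul hφ

end Integrability

/-- The very weak form of the equation. -/
theorem IsWeakSolution.integral_eq {Ω : Set (E n)} {p : ℝ} {u : E n → ℝ}
    (h : IsWeakSolution Ω p u) (hu : MemL2Loc Ω u) {φ : E n → ℝ} (hφ : IsTestFunction Ω φ) :
    ∫ x, |u x| ^ (p - 1) * u x * φ x = -∫ x, u x * (Δ (Δ (Δ φ))) x := by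
  obtain ⟨G, ⟨hG, hGφ⟩, hsol⟩ := h
  rw [← hsol φ hφ]
  have hcomp : ∀ i : Fin n, ∫ x, G x i * pd i (Δ φ) x
      = -∫ x, u x * pd i (pd i (Δ (Δ φ))) x := by
    intro i
    have ht : IsTestFunction Ω (pd i (Δ φ)) := hφ.laplacian.pd i
    -- Testing the definition of `G` with `∂ᵢ Δφ` and reading the `i`-th component moves all
    -- derivatives onto the test function.
    have h1 := congrArg (fun v : E n => v i) (hGφ _ ht)
    have h2 : Integrable fun x => u x • gradient (Δ (pd i (Δ φ))) x := by
      have : ∀ j, Integrable fun x => u x * pd j (Δ (pd i (Δ φ))) x := fun j =>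
        hu.integrable_mul (ht.laplacian.pd j)
      have h3 : (fun x => u x • gradient (Δ (pd i (Δ φ))) x) = fun x =>
          ∑ j, (u x * pd j (Δ (pd i (Δ φ))) x) • EuclideanSpace.single j (1 : ℝ) := by
        ext x j
        simp [Pi.single_apply, gradient_apply]
      rw [h3]
      exact integrable_finsetSum _ fun j _ => (this j).smul_const _
    have h4 := (EuclideanSpace.proj (𝕜 := ℝ) i).integral_comp_comm (hG.integrable_smul ht)
    have h5 := (EuclideanSpace.proj (𝕜 := ℝ) i).integral_comp_comm h2
    simp only [EuclideanSpace.coe_proj, PiLp.smul_apply, smul_eq_mul, gradient_apply] at h4 h5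
    simp only [PiLp.neg_apply] at h1
    rw [← h4, ← h5] at h1
    simp only [mul_comm (G _ i)]
    rw [h1, pd_laplacian hφ.laplacian.1 i |>.symm]
  have hint : ∀ i : Fin n, Integrable fun x => G x i * pd i (Δ φ) x := fun i => by
    have := (EuclideanSpace.proj (𝕜 := ℝ) i).integrable_comp
      (hG.integrable_smul (hφ.laplacian.pd i))
    simpa [mul_comm] using this
  calc ∫ x, ⟪G x, gradient (Δ φ) x⟫ = ∫ x, ∑ i, G x i * pd i (Δ φ) x := by
        refine integral_congr_ae (.of_forall fun x => ?_)
        change inner ℝ (G x) (gradient (Δ φ) x) = _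
        rw [PiLp.inner_apply]
        simp [gradient_apply, mul_comm]
    _ = -∑ i, ∫ x, u x * pd i (pd i (Δ (Δ φ))) x := by
        rw [integral_finsetSum _ fun i _ => hint i, ← Finset.sum_neg_distrib]
        exact Finset.sum_congr rfl fun i _ => hcomp i
    _ = _ := by
        rw [laplacian_eq_sum_pd hφ.laplacian.laplacian.1]
        simp only [Finset.mul_sum]
        rw [integral_finsetSum _ fun i _ =>
          hu.integrable_mul ((hφ.laplacian.laplacian.pd i).pd i)]

/-! ### The third power of the Laplacian -/

-- The expansion of `(R(a-4) + L)(R(a-2) + L)(R(a) + L)` in powers of `L`, where `R` is `radial`: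
-- each Laplacian lowers the degree by two.
open Polynomial in
theorem laplacian_cubed_sep (a : ℝ) (η : Profile) (q : HomZero n) :
    Δ (Δ (Δ (sep a η q)))
      = sep (a - 6) (aeval Profile.der (radial n (a - 4) * radial n (a - 2) * radial n a) η) q
        + sep (a - 6) (aeval Profile.der (radial n (a - 4) * radial n (a - 2)
            + radial n (a - 2) * radial n a + radial n (a - 4) * radial n a) η) (HomZero.lap q)
        + sep (a - 6) (aeval Profile.der (radial n (a - 4) + radial n (a - 2) + radial n a) η)
            (HomZero.lap (HomZero.lap q))
        + sep (a - 6) η (HomZero.lap (HomZero.lap (HomZero.lap q))) := by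
  have hc : ∀ (b : ℝ) (ζ : Profile) (r : HomZero n), ContDiff ℝ ∞ (sep b ζ r) := contDiff_sep
  have hadd : ∀ (b : ℝ) (ζ ζ' : Profile) (r r' : HomZero n),
      ContDiff ℝ ∞ (sep b ζ r + sep b ζ' r') := fun b ζ ζ' r r' => (hc b ζ r).add (hc b ζ' r')
  rw [laplacian_sep, laplacian_add (hc _ _ _) (hc _ _ _), laplacian_sep, laplacian_sep,
    laplacian_add (hadd _ _ _ _ _) (hadd _ _ _ _ _),
    laplacian_add (hc _ _ _) (hc _ _ _), laplacian_add (hc _ _ _) (hc _ _ _),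
    laplacian_sep, laplacian_sep, laplacian_sep, laplacian_sep,
    show a - 2 - 2 - 2 = a - 6 by ring, show a - 2 - 2 = a - 4 by ring]
  simp only [map_mul, map_add, Module.End.mul_apply, LinearMap.add_apply, sep_add_left]
  abel

-- Every term of `P(D) η` except the constant one is a derivative and integrates to zero.
open Polynomial in
theorem Profile.integral_aeval (P : ℝ[X]) (η : Profile) :
    ∫ s, (aeval der P η).1 s = P.eval 0 * ∫ s, η.1 s := by
  have h : (aeval der P η) = der (aeval der P.divX η) + P.eval 0 • η := by
    conv_lhs => rw [← P.X_mul_divX_add]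
    simp [coeff_zero_eq_eval_zero]
  rw [h]
  simp only [Submodule.coe_add, Pi.add_apply, SetLike.val_smul, Pi.smul_apply, smul_eq_mul]
  rw [integral_add (integrable _) ((integrable η).const_mul _), integral_der, zero_add,
    integral_const_mul]

theorem radial_eval_zero (a : ℝ) : (radial n a).eval 0 = a * (a + n - 2) := by
  simp [radial]

theorem integral_add₄ {f₁ f₂ f₃ f₄ : E n → ℝ} (h₁ : Integrable f₁) (h₂ : Integrable f₂)
    (h₃ : Integrable f₃) (h₄ : Integrable f₄) :
    ∫ x, f₁ x + f₂ x + f₃ x + f₄ x = (∫ x, f₁ x) + (∫ x, f₂ x) + (∫ x, f₃ x) + ∫ x, f₄ x := by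
  have h₁₂ : Integrable fun x => f₁ x + f₂ x := h₁.add h₂
  have h₁₃ : Integrable fun x => f₁ x + f₂ x + f₃ x := h₁₂.add h₃
  rw [integral_add h₁₃ h₄, integral_add h₁₂ h₃, integral_add h₁ h₂]

/-- The equation, reduced to the sphere. -/
theorem sphere_equation (hn : n ≠ 0) {p k : ℝ} (hk : k * (p - 1) = 6) {u w : E n → ℝ}
    (hu : MemL2Loc {0}ᶜ u) (hhom : ∀ᵐ x, u x = ‖x‖ ^ (-k) * w (‖x‖⁻¹ • x))
    (hsol : IsWeakSolution {0}ᶜ p u) {c₁ c₂ c₃ : ℝ} (hc₁ : c₁ = k * (n - 2 - k))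
    (hc₂ : c₂ = (k + 2) * (n - 4 - k)) (hc₃ : c₃ = (k + 4) * (n - 6 - k)) (q : HomZero n) :
    ∫ θ, |w θ| ^ (p - 1) * w θ * q.1 θ ∂sphereMeasure n
      = c₁ * c₂ * c₃ * ∫ θ, w θ * q.1 θ ∂sphereMeasure n
        - (c₁ * c₂ + c₂ * c₃ + c₁ * c₃) * ∫ θ, w θ * (HomZero.lap q).1 θ ∂sphereMeasure n
        + (c₁ + c₂ + c₃) * ∫ θ, w θ * (HomZero.lap (HomZero.lap q)).1 θ ∂sphereMeasure n
        - ∫ θ, w θ * (HomZero.lap (HomZero.lap (HomZero.lap q))).1 θ ∂sphereMeasure n := by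
  obtain ⟨b, hb⟩ : ∃ b : ContDiffBump (0 : ℝ), b = default := ⟨_, rfl⟩
  obtain ⟨η, hη⟩ : ∃ η : Profile, 0 < ∫ s, η.1 s := by
    refine ⟨⟨b, b.contDiff, b.hasCompactSupport⟩, b.integral_pos⟩
  -- This degree brings both sides of the equation to total degree `-n`, because `k p = k + 6`.
  obtain ⟨a, ha⟩ : ∃ a : ℝ, a = k + 6 - n := ⟨_, rfl⟩
  have hab : -k + (a - 6) = -n := by rw [ha]; ring
  have hap : -k * p + a = -n := by rw [ha]; linarith
  have hpow : ∀ᵐ x, |u x| ^ (p - 1) * u x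
      = ‖x‖ ^ (-k * p) * (|w (‖x‖⁻¹ • x)| ^ (p - 1) * w (‖x‖⁻¹ • x)) := by
    filter_upwards [hhom, ae_ne_zero hn] with x hx h0
    have hr : 0 < ‖x‖ := norm_pos_iff.mpr h0
    rw [hx, abs_mul, abs_of_nonneg (Real.rpow_nonneg hr.le _),
      Real.mul_rpow (Real.rpow_nonneg hr.le _) (abs_nonneg _), ← Real.rpow_mul hr.le,
      show -k * p = -k * (p - 1) + -k by ring, Real.rpow_add hr]
    ring
  have heq := hsol.integral_eq hu (isTestFunction_sep a η q)
  rw [integral_hom_mul_sep hn (v := fun x => |w x| ^ (p - 1) * w x) hpow hap,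
    laplacian_cubed_sep] at heq
  have hi : ∀ (ζ : Profile) (r : HomZero n), Integrable fun x => u x * sep (a - 6) ζ r x :=
    fun ζ r => hu.integrable_mul (isTestFunction_sep _ ζ r)
  simp only [Pi.add_apply, mul_add] at heq
  rw [integral_add₄ (hi _ _) (hi _ _) (hi _ _) (hi _ _)] at heq
  simp only [integral_hom_mul_sep hn hhom hab, Profile.integral_aeval, Polynomial.eval_add,
    Polynomial.eval_mul, radial_eval_zero] at heq
  -- The three radial symbols at zero are `-c₃, -c₂, -c₁`, in reverse order.
  have e1 : a * (a + n - 2) = -c₃ := by rw [ha, hc₃]; ring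
  have e2 : (a - 2) * (a - 2 + n - 2) = -c₂ := by rw [ha, hc₂]; ring
  have e3 : (a - 4) * (a - 4 + n - 2) = -c₁ := by rw [ha, hc₁]; ring
  rw [e1, e2, e3] at heq
  refine mul_left_cancel₀ hη.ne' (heq.trans ?_)
  ring

/-! ### Stability on the sphere -/

namespace Profile

/-- The dilate `η(c ·)` of a profile. -/
def dilate (c : ℝ) (hc : c ≠ 0) (η : Profile) : Profile :=
  ⟨fun s => η.1 (c * s), (contDiff η).comp (contDiff_const.mul contDiff_id),
    (hasCompactSupport η).comp_homeomorph (Homeomorph.mulLeft₀ c hc)⟩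

theorem der_dilate (c : ℝ) (hc : c ≠ 0) (η : Profile) :
    der (dilate c hc η) = c • dilate c hc (der η) := by
  ext s
  have := ((differentiable η (c * s)).hasDerivAt.comp s
    ((hasDerivAt_id s).const_mul c)).deriv
  simp only [der_apply, dilate, SetLike.val_smul, Pi.smul_apply, smul_eq_mul]
  rw [Function.comp_def] at this
  rw [this]; ring

theorem der_pow_dilate (c : ℝ) (hc : c ≠ 0) (η : Profile) (i : ℕ) :
    (der ^ i) (dilate c hc η) = c ^ i • dilate c hc ((der ^ i) η) := by
  induction i with
  | zero => simp
  | succ i ih =>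
    rw [pow_succ', Module.End.mul_apply, ih, map_smul, der_dilate, smul_smul, pow_succ,
      Module.End.mul_apply]

theorem integral_dilate_mul_dilate (c : ℝ) (hc : 0 < c) (η ζ : Profile) :
    c * ∫ s, (dilate c hc.ne' η).1 s * (dilate c hc.ne' ζ).1 s = ∫ s, η.1 s * ζ.1 s := by
  have := Measure.integral_comp_mul_left (fun s => η.1 s * ζ.1 s) c
  simp only [dilate]
  rw [this, abs_of_pos (inv_pos.mpr hc), smul_eq_mul, mul_inv_cancel_left₀ hc.ne']

theorem integrable_mul (η ζ : Profile) : Integrable fun s => η.1 s * ζ.1 s :=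
  ((continuous η).mul (continuous ζ)).integrable_of_hasCompactSupport
    (hasCompactSupport ζ).mul_left

open Polynomial in
theorem integral_dilate_mul_aeval (P : ℝ[X]) (η : Profile) (c : ℝ) (hc : 0 < c) :
    c * ∫ s, (dilate c hc.ne' η).1 s * (aeval der P (dilate c hc.ne' η)).1 s
      = ∑ i ∈ Finset.range (P.natDegree + 1), P.coeff i * c ^ i * ∫ s, η.1 s * ((der ^ i) η).1 s := by
  have h : ∀ s, (dilate c hc.ne' η).1 s * (aeval der P (dilate c hc.ne' η)).1 s
      = ∑ i ∈ Finset.range (P.natDegree + 1), (P.coeff i * c ^ i) *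
        ((dilate c hc.ne' η).1 s * (dilate c hc.ne' ((der ^ i) η)).1 s) := by
    intro s
    rw [aeval_eq_sum_range, LinearMap.sum_apply]
    simp only [LinearMap.smul_apply, der_pow_dilate, AddSubmonoidClass.coe_finsetSum,
      Finset.sum_apply, SetLike.val_smul, Pi.smul_apply, smul_eq_mul, Finset.mul_sum]
    exact Finset.sum_congr rfl fun i _ => by ring
  simp only [h]
  rw [integral_finsetSum _ fun i _ => (integrable_mul _ _).const_mul _, Finset.mul_sum]
  refine Finset.sum_congr rfl fun i _ => ?_
  rw [integral_const_mul, mul_left_comm, integral_dilate_mul_dilate c hc]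

-- Each derivative of `η(c ·)` gains a factor `c`, so the normalized integral is a polynomial in
-- `c`; only its constant term survives as `c → 0`.
open Polynomial Filter Topology in
theorem exists_tendsto_dilate (P : ℝ[X]) (η : Profile) :
    ∃ f : ℝ → ℝ, Tendsto f (𝓝[>] 0) (𝓝 (P.eval 0 * ∫ s, η.1 s * η.1 s)) ∧
      ∀ c (hc : 0 < c), f c
        = c * ∫ s, (dilate c hc.ne' η).1 s * (aeval der P (dilate c hc.ne' η)).1 s := by
  refine ⟨fun c => ∑ i ∈ Finset.range (P.natDegree + 1),
    P.coeff i * c ^ i * ∫ s, η.1 s * ((der ^ i) η).1 s, ?_,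
    fun c hc => (integral_dilate_mul_aeval P η c hc).symm⟩
  have hcont : Continuous fun c : ℝ => ∑ i ∈ Finset.range (P.natDegree + 1),
    P.coeff i * c ^ i * ∫ s, η.1 s * ((der ^ i) η).1 s := by fun_prop
  have := (hcont.tendsto 0).mono_left (nhdsWithin_le_nhds (s := Set.Ioi 0))
  convert this using 2
  rw [Finset.sum_eq_single 0 (fun i _ hi => by simp [hi]) (by simp)]
  simp [coeff_zero_eq_eval_zero]

end Profile

open Filter Topology in
/-- The stability inequality, reduced to the sphere. -/
theorem sphere_stability (hn : n ≠ 0) {p k : ℝ} (hk : k * (p - 1) = 6) {u w : E n → ℝ}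
    (hhom : ∀ᵐ x, u x = ‖x‖ ^ (-k) * w (‖x‖⁻¹ • x))
    (hstab : IsStable {0}ᶜ p u) {b₁ b₂ : ℝ} (hb₁ : b₁ = ((n : ℝ) / 2 - 3) * (n / 2 + 1))
    (hb₂ : b₂ = ((n : ℝ) / 2 - 1) ^ 2) (q : HomZero n) :
    p * ∫ θ, |w θ| ^ (p - 1) * q.1 θ ^ 2 ∂sphereMeasure n
      ≤ b₁ * b₂ * b₁ * HomZero.ip q q
        - (b₁ * b₂ + b₂ * b₁ + b₁ * b₁) * HomZero.ip q (HomZero.lap q)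
        + (b₁ + b₂ + b₁) * HomZero.ip q (HomZero.lap (HomZero.lap q))
        - HomZero.ip q (HomZero.lap (HomZero.lap (HomZero.lap q))) := by
  obtain ⟨η, hη⟩ := exists_profile
  -- The borderline Hardy–Rellich degree: both `|u|^(p-1) φ²` and `φ Δ³φ` have total degree `-n`.
  obtain ⟨a, ha⟩ : ∃ a : ℝ, a = 3 - n / 2 := ⟨_, rfl⟩
  have hab : a + (a - 6) = -n := by rw [ha]; ring
  have hquad : ∀ ζ : Profile, ∫ x, |u x| ^ (p - 1) * sep a ζ q x ^ 2
      = (∫ s, ζ.1 s * ζ.1 s) * ∫ θ, |w θ| ^ (p - 1) * q.1 θ ^ 2 ∂sphereMeasure n := by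
    intro ζ
    rw [← integral_polar hn (fun s => ζ.1 s * ζ.1 s) fun x => |w x| ^ (p - 1) * q.1 x ^ 2]
    refine integral_congr_ae ?_
    filter_upwards [hhom, ae_ne_zero hn] with x hx h0
    have hr : 0 < ‖x‖ := norm_pos_iff.mpr h0
    rw [hx, abs_mul, abs_of_nonneg (Real.rpow_nonneg hr.le _),
      Real.mul_rpow (Real.rpow_nonneg hr.le _) (abs_nonneg _), ← Real.rpow_mul hr.le,
      HomZero.apply_normalize q h0, sep_apply, ← hab,
      show a + (a - 6) = -k * (p - 1) + (a + a) by rw [neg_mul, hk]; ring, Real.rpow_add hr,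
      Real.rpow_add hr]
    ring
  obtain ⟨f₁, hf₁, hf₁'⟩ := Profile.exists_tendsto_dilate
    (radial n (a - 4) * radial n (a - 2) * radial n a) η
  obtain ⟨f₂, hf₂, hf₂'⟩ := Profile.exists_tendsto_dilate (radial n (a - 4) * radial n (a - 2)
            + radial n (a - 2) * radial n a + radial n (a - 4) * radial n a) η
  obtain ⟨f₃, hf₃, hf₃'⟩ := Profile.exists_tendsto_dilate
    (radial n (a - 4) + radial n (a - 2) + radial n a) η
  have hineq : ∀ c : ℝ, 0 < c →
      p * ((∫ s, η.1 s * η.1 s) * ∫ θ, |w θ| ^ (p - 1) * q.1 θ ^ 2 ∂sphereMeasure n)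
        ≤ -(f₁ c * HomZero.ip q q + f₂ c * HomZero.ip q (HomZero.lap q)
          + f₃ c * HomZero.ip q (HomZero.lap (HomZero.lap q))
          + (∫ s, η.1 s * η.1 s) * HomZero.ip q (HomZero.lap (HomZero.lap (HomZero.lap q)))) := by
    intro c hc
    have ht := isTestFunction_sep a (Profile.dilate c hc.ne' η) q
    have h := hstab _ ht
    rw [hquad, integral_norm_gradient_laplacian_sq ht.1 ht.2.1, laplacian_cubed_sep] at h
    have hi : ∀ (ζ : Profile) (r : HomZero n), Integrable fun x =>
        sep a (Profile.dilate c hc.ne' η) q x * sep (a - 6) ζ r x :=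
      fun ζ r => integrable_mul_of_hasCompactSupport (contDiff_sep _ _ _).continuous
        (contDiff_sep _ _ _).continuous (isTestFunction_sep _ ζ r).2.1
    simp only [Pi.add_apply, mul_add] at h
    rw [integral_add₄ (hi _ _) (hi _ _) (hi _ _) (hi _ _)] at h
    simp only [integral_sep_mul_sep hn hab] at h
    have h' := mul_le_mul_of_nonneg_left h hc.le
    rw [hf₁' c hc, hf₂' c hc, hf₃' c hc, ← Profile.integral_dilate_mul_dilate c hc η η]
    unfold HomZero.ip
    linarith
  -- As `c → 0` the profile varies slowly and only the symbols at zero, `-b₁, -b₂, -b₁`, remain.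
  have hlim := ge_of_tendsto ((((hf₁.mul_const (HomZero.ip q q)).add
    (hf₂.mul_const (HomZero.ip q (HomZero.lap q)))).add
    (hf₃.mul_const (HomZero.ip q (HomZero.lap (HomZero.lap q))))).add_const
    ((∫ s, η.1 s * η.1 s) * HomZero.ip q (HomZero.lap (HomZero.lap (HomZero.lap q))))).neg
    (eventually_mem_nhdsWithin.mono fun c hc => hineq c hc)
  simp only [Polynomial.eval_add, Polynomial.eval_mul, radial_eval_zero] at hlim
  have e1 : a * (a + n - 2) = -b₁ := by rw [ha, hb₁]; ring
  have e2 : (a - 2) * (a - 2 + n - 2) = -b₂ := by rw [ha, hb₂]; ring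
  have e3 : (a - 4) * (a - 4 + n - 2) = -b₁ := by rw [ha, hb₁]; ring
  rw [e1, e2, e3] at hlim
  refine le_of_mul_le_mul_left ?_ hη
  linarith

namespace HomZero

/-! ### Restrictions of polynomials to the sphere -/

/-- Polynomials of degree at most `m` in the coordinates `xᵢ / ‖x‖`. -/
def polys (n : ℕ) : ℕ → Submodule ℝ (HomZero n)
  | 0 => Submodule.span ℝ {unit n}
  | m + 1 => polys n m ⊔ ⨆ i, (polys n m).map (LinearMap.mulLeft ℝ (coord i))

theorem polys_succ (m : ℕ) :
    polys n (m + 1) = polys n m ⊔ ⨆ i, (polys n m).map (LinearMap.mulLeft ℝ (coord i)) := rfl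

theorem polys_mono : Monotone (polys n) := monotone_nat_of_le_succ fun _ => le_sup_left

instance finiteDimensional_polys (m : ℕ) : FiniteDimensional ℝ (polys n m) := by
  induction m with
  | zero => exact FiniteDimensional.span_singleton ℝ _
  | succ m ih => rw [polys_succ]; infer_instance

theorem unit_mem_polys (m : ℕ) : unit n ∈ polys n m :=
  polys_mono (Nat.zero_le m) (Submodule.mem_span_singleton_self _)

theorem coord_mul_mem_polys {m : ℕ} (i : Fin n) {q : HomZero n} (hq : q ∈ polys n m) :
    coord i * q ∈ polys n (m + 1) :=
  Submodule.mem_sup_right (Submodule.mem_iSup_of_mem i ⟨q, hq, rfl⟩)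

theorem polys_succ_le {m : ℕ} {W : Submodule ℝ (HomZero n)} (h0 : polys n m ≤ W)
    (h1 : ∀ i, ∀ q ∈ polys n m, coord i * q ∈ W) : polys n (m + 1) ≤ W :=
  sup_le h0 (iSup_le fun i => Submodule.map_le_iff_le_comap.mpr fun q hq => h1 i q hq)

theorem ite_unit_mul (P : Prop) [Decidable P] (q : HomZero n) :
    (if P then unit n else 0) * q = if P then q else 0 := by
  split_ifs
  · exact unit_mul q
  · exact zero_mul q

/-- An angular derivative sends `xⱼ` to `δᵢⱼ - xᵢ xⱼ`, so it raises the degree by at most one. -/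
theorem ang_mem_polys (i : Fin n) (m : ℕ) : polys n m ≤ (polys n (m + 1)).comap (ang i) := by
  induction m with
  | zero =>
    refine Submodule.span_le.mpr fun q hq => ?_
    rw [Set.mem_singleton_iff] at hq
    simp [hq, ang_unit]
  | succ m ih =>
    refine polys_succ_le (fun q hq => polys_mono (Nat.le_succ _) (ih hq)) fun j q hq => ?_
    rw [Submodule.mem_comap, ang_mul, ang_coord, mul_comm q, sub_mul, ite_unit_mul, mul_assoc]
    refine add_mem (coord_mul_mem_polys j (ih hq)) (sub_mem ?_ ?_)
    · split_ifs
      · exact polys_mono (by omega) hq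
      · exact zero_mem _
    · exact coord_mul_mem_polys i (coord_mul_mem_polys j hq)

theorem lap_coord (j : Fin n) : lap (coord j) = (1 - (n : ℝ)) • coord j := by
  have h : ∀ i, ang i (ang i (coord j)) = coord j * (coord i * coord i) - coord j * unit n
      - coord i * ang i (coord j) := by
    intro i
    have h1 : ang i (if i = j then unit n else 0) = 0 := by split_ifs <;> simp [ang_unit]
    conv_lhs => rw [ang_coord, map_sub, h1, ang_mul, ang_coord i i, if_pos rfl, mul_sub]
    abel
  rw [lap_apply]
  simp only [h, Finset.sum_sub_distrib, sum_coord_mul_ang, ← Finset.mul_sum, sum_coord_mul_self,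
    Finset.sum_const, Finset.card_univ, Fintype.card_fin]
  rw [mul_smul_comm, mul_comm, unit_mul, sub_zero, sub_smul, one_smul, Nat.cast_smul_eq_nsmul]

theorem sum_ang_coord_mul_ang (j : Fin n) (q : HomZero n) :
    ∑ i, ang i (coord j) * ang i q = ang j q := by
  have h : ∀ i, ang i (coord j) * ang i q
      = (if i = j then ang i q else 0) - coord j * (coord i * ang i q) := fun i => by
    rw [ang_coord, sub_mul, ite_unit_mul, mul_comm (coord i), mul_assoc]
  simp only [h, Finset.sum_sub_distrib, ← Finset.mul_sum, sum_coord_mul_ang]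
  simp

/-- In the product rule for `L(xⱼ q)` the cross term collapses to `ang j q`, whose degree is at most
`m + 1`. This invariance does the work of a decomposition into spherical harmonics. -/
theorem lap_mem_polys (m : ℕ) : polys n m ≤ (polys n m).comap lap := by
  induction m with
  | zero =>
    refine Submodule.span_le.mpr fun q hq => ?_
    rw [Set.mem_singleton_iff] at hq
    simp [hq, lap_apply, ang_unit]
  | succ m ih =>
    refine polys_succ_le (fun q hq => polys_mono (Nat.le_succ _) (ih hq)) fun j q hq => ?_
    rw [Submodule.mem_comap, lap_mul, sum_ang_coord_mul_ang, lap_coord, mul_comm q,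
      smul_mul_assoc]
    exact add_mem (add_mem (coord_mul_mem_polys j (ih hq))
      (Submodule.smul_mem _ _ (coord_mul_mem_polys j hq)))
      (Submodule.smul_mem _ _ (ang_mem_polys j m hq))

/-! ### Density in `L²` -/

/-- Restriction to the unit sphere. -/
def toSphere (n : ℕ) : HomZero n →ₗ[ℝ] C(Metric.sphere (0 : E n) 1, ℝ) where
  toFun q := ⟨fun θ => q.1 θ, continuous_sphere q⟩
  map_add' _ _ := rfl
  map_smul' _ _ := rfl

theorem toSphere_unit : toSphere n (unit n) = 1 := by
  ext θ
  exact unit_apply (ne_zero_of_mem_unit_sphere θ)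

theorem adjoin_coord_le :
    (Algebra.adjoin ℝ (Set.range fun i => toSphere n (coord i))).toSubmodule
      ≤ ⨆ m, (polys n m).map (toSphere n) := by
  rw [Algebra.adjoin_eq_span, Submodule.span_le]
  have hmono : Monotone fun m => (polys n m).map (toSphere n) := fun _ _ h =>
    Submodule.map_mono (polys_mono h)
  intro f hf
  refine Submonoid.closure_induction_left (motive := fun f _ =>
    f ∈ ⨆ m, (polys n m).map (toSphere n)) ?_ ?_ hf
  · exact Submodule.mem_iSup_of_mem 0 ⟨unit n, unit_mem_polys 0, toSphere_unit⟩
  · rintro _ ⟨i, rfl⟩ g - hg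
    rw [Submodule.mem_iSup_of_directed _ hmono.directed_le] at hg
    obtain ⟨m, q, hq, rfl⟩ := hg
    exact Submodule.mem_iSup_of_mem (m + 1) ⟨coord i * q, coord_mul_mem_polys i hq, rfl⟩

theorem adjoin_coord_separatesPoints :
    (Algebra.adjoin ℝ (Set.range fun i => toSphere n (coord i))).SeparatesPoints := by
  intro θ θ' h
  obtain ⟨i, hi⟩ : ∃ i, (θ : E n) i ≠ (θ' : E n) i := by
    by_contra! hc
    exact h (Subtype.ext (PiLp.ext hc))
  refine ⟨_, ⟨_, Algebra.subset_adjoin ⟨i, rfl⟩, rfl⟩, ?_⟩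
  change (coord i).1 θ ≠ (coord i).1 θ'
  rwa [coord_apply, coord_apply, norm_eq_of_mem_sphere θ, norm_eq_of_mem_sphere θ', div_one,
    div_one]

/-- The class in `L²` of the sphere of a homogeneous function. -/
def toL2 (n : ℕ) : HomZero n →ₗ[ℝ] Lp ℝ 2 (sphereMeasure n) :=
  (ContinuousMap.toLp 2 (sphereMeasure n) ℝ).toLinearMap ∘ₗ toSphere n

theorem coeFn_toL2 (q : HomZero n) : toL2 n q =ᵐ[sphereMeasure n] fun θ => q.1 θ :=
  ContinuousMap.coeFn_toLp (sphereMeasure n) (toSphere n q)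

/-- Stone–Weierstrass for the algebra generated by the coordinates, followed by the density of
continuous functions in `L²`. -/
theorem iSup_map_toL2_dense :
    ⊤ ≤ (⨆ m, (polys n m).map (toL2 n)).topologicalClosure := by
  rw [top_le_iff, ← Submodule.dense_iff_topologicalClosure_eq_top]
  have h1 : Dense (Algebra.adjoin ℝ (Set.range fun i => toSphere n (coord i)) :
      Set C(Metric.sphere (0 : E n) 1, ℝ)) := by
    have := ContinuousMap.subalgebra_topologicalClosure_eq_top_of_separatesPoints _
      (adjoin_coord_separatesPoints (n := n))
    rw [dense_iff_closure_eq, ← Subalgebra.topologicalClosure_coe, this]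
    rfl
  have h2 := (ContinuousMap.toLp_denseRange ℝ (sphereMeasure n) ℝ (p := 2) (by simp)).dense_image
    (ContinuousLinearMap.continuous _) h1
  refine h2.mono ?_
  rintro _ ⟨f, hf, rfl⟩
  have h3 := Submodule.mem_map_of_mem (f := (ContinuousMap.toLp 2 (sphereMeasure n) ℝ).toLinearMap)
    (adjoin_coord_le hf)
  rw [Submodule.map_iSup] at h3
  simp only [← Submodule.map_comp] at h3
  exact h3

open Filter Topology in
/-- Projections onto invariant spaces of polynomials: every `w` in `L²` of the sphere is the
almost everywhere limit of functions `ψ` that have the same moments as `w` against an invariant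
space containing `ψ`. -/
theorem exists_approx {w : E n → ℝ}
    (hw : MemLp (fun θ : Metric.sphere (0 : E n) 1 => w θ) 2 (sphereMeasure n)) :
    ∃ ψ : ℕ → HomZero n,
      (∀ m, ∃ W : Submodule ℝ (HomZero n), ψ m ∈ W ∧ W ≤ W.comap lap ∧
        ∀ r ∈ W, ∫ θ, w θ * r.1 θ ∂sphereMeasure n = ip (ψ m) r) ∧
      ∀ᵐ θ : Metric.sphere (0 : E n) 1 ∂sphereMeasure n,
        Tendsto (fun m => (ψ m).1 θ) atTop (𝓝 (w θ)) := by
  let U : ℕ → Submodule ℝ (Lp ℝ 2 (sphereMeasure n)) := fun m => (polys n m).map (toL2 n)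
  have hU : Monotone U := fun _ _ h => Submodule.map_mono (polys_mono h)
  have hfin : ∀ m, FiniteDimensional ℝ (U m) := fun m => by
    change FiniteDimensional ℝ ((polys n m).map (toL2 n)); infer_instance
  have hlim := Submodule.starProjection_tendsto_self U hU (hw.toLp _) iSup_map_toL2_dense
  have hmem : ∀ m, ∃ ψ ∈ polys n m, toL2 n ψ = (U m).starProjection (hw.toLp _) := fun m =>
    Submodule.starProjection_apply_mem (U m) (hw.toLp _)
  choose ψ hψ hψ' using hmem
  -- The projections converge in `L²`; a subsequence converges almost everywhere, as Fatou's lemma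
  -- will require.
  obtain ⟨ns, -, hns⟩ := (tendstoInMeasure_of_tendsto_Lp hlim).exists_seq_tendsto_ae
  refine ⟨fun m => ψ (ns m), fun m => ⟨polys n (ns m), hψ _, lap_mem_polys _, fun r hr => ?_⟩, ?_⟩
  -- The residual `w - ψ` is orthogonal to the whole polynomial space, which is the equality of
  -- moments.
  · have h1 : inner ℝ (toL2 n r) (hw.toLp _ - toL2 n (ψ (ns m))) = 0 := by
      rw [hψ']
      exact Submodule.sub_starProjection_mem_orthogonal (K := U (ns m)) (hw.toLp _) _ ⟨r, hr, rfl⟩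
    rw [inner_sub_right, sub_eq_zero, L2.inner_def, L2.inner_def] at h1
    have h2 : ∫ θ, w θ * r.1 θ ∂sphereMeasure n
        = ∫ θ, inner ℝ (toL2 n r θ) (hw.toLp _ θ) ∂sphereMeasure n := by
      refine integral_congr_ae ?_
      filter_upwards [coeFn_toL2 r, hw.coeFn_toLp] with θ h3 h4
      rw [h3, h4]; simp
    have h5 : ip (ψ (ns m)) r
        = ∫ θ, inner ℝ (toL2 n r θ) (toL2 n (ψ (ns m)) θ) ∂sphereMeasure n := by
      refine integral_congr_ae ?_
      filter_upwards [coeFn_toL2 r, coeFn_toL2 (ψ (ns m))] with θ h3 h4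
      rw [h3, h4]; simp
    rw [h2, h1, h5]
  · have h : ∀ᵐ θ ∂sphereMeasure n, ∀ m, toL2 n (ψ (ns m)) θ = (ψ (ns m)).1 θ :=
      ae_all_iff.mpr fun m => coeFn_toL2 _
    filter_upwards [h, hns, hw.coeFn_toLp] with θ h1 h2 h3
    simp only [← hψ', h1, h3] at h2
    exact h2

end HomZero

/-! ### Polar coordinates as a measure preserving map -/

/-- Polar coordinates `(r, θ) ↦ r θ`. -/
def polarMap (n : ℕ) (y : Set.Ioi (0 : ℝ) × Metric.sphere (0 : E n) 1) : E n :=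
  (y.1 : ℝ) • (y.2 : E n)

theorem polarMap_eq : polarMap n
    = Subtype.val ∘ (homeomorphUnitSphereProd (E n)).symm ∘ Prod.swap := by
  ext y
  simp [polarMap]

theorem measurePreserving_polarMap (hn : n ≠ 0) :
    MeasurePreserving (polarMap n) ((Measure.volumeIoiPow (n - 1)).prod (sphereMeasure n))
      volume := by
  have hpres := (volume : Measure (E n)).measurePreserving_homeomorphUnitSphereProd
  rw [finrank_euclideanSpace_fin] at hpres
  have h1 : MeasurePreserving (homeomorphUnitSphereProd (E n)).symm
      ((sphereMeasure n).prod (Measure.volumeIoiPow (n - 1)))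
      ((volume : Measure (E n)).comap Subtype.val) :=
    MeasurePreserving.symm (homeomorphUnitSphereProd (E n)).toMeasurableEquiv hpres
  have : Nonempty (Fin n) := ⟨⟨0, Nat.pos_of_ne_zero hn⟩⟩
  have h2 : MeasurePreserving (Subtype.val : ({0}ᶜ : Set (E n)) → E n)
      ((volume : Measure (E n)).comap Subtype.val) volume := by
    refine ⟨measurable_subtype_coe, ?_⟩
    rw [map_comap_subtype_coe (measurableSet_singleton _).compl, restrict_compl_singleton]
  rw [polarMap_eq]
  exact h2.comp (h1.comp Measure.measurePreserving_swap)

theorem measurableEmbedding_polarMap : MeasurableEmbedding (polarMap n) := by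
  rw [polarMap_eq]
  exact (MeasurableEmbedding.subtype_coe (measurableSet_singleton _).compl).comp
    ((homeomorphUnitSphereProd (E n)).symm.measurableEmbedding.comp
      MeasurableEquiv.prodComm.measurableEmbedding)

theorem norm_polarMap (y : Set.Ioi (0 : ℝ) × Metric.sphere (0 : E n) 1) :
    ‖polarMap n y‖ = y.1 := by
  rw [polarMap, norm_smul, norm_eq_of_mem_sphere, mul_one, Real.norm_eq_abs, abs_of_pos y.1.2]

theorem normalize_polarMap (y : Set.Ioi (0 : ℝ) × Metric.sphere (0 : E n) 1) :
    ‖polarMap n y‖⁻¹ • polarMap n y = y.2 := by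
  rw [norm_polarMap, polarMap, smul_smul, inv_mul_cancel₀ (ne_of_gt y.1.2), one_smul]

/-- Radii in `[1, 2)` are not negligible, so a property of almost every radius holds at one of them.
-/
theorem volumeIoiPow_shell_ne_zero (m : ℕ) :
    Measure.volumeIoiPow m {r | 1 ≤ (r : ℝ) ∧ (r : ℝ) < 2} ≠ 0 := by
  intro h0
  have h1 := Measure.volumeIoiPow_apply_Iio m ⟨1, Set.mem_Ioi.mpr one_pos⟩
  have h2 := Measure.volumeIoiPow_apply_Iio m ⟨2, Set.mem_Ioi.mpr two_pos⟩
  have h3 : Measure.volumeIoiPow m (Set.Iio ⟨2, Set.mem_Ioi.mpr two_pos⟩)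
      ≤ Measure.volumeIoiPow m (Set.Iio ⟨1, Set.mem_Ioi.mpr one_pos⟩) + 0 := by
    rw [← h0]
    refine (measure_mono fun r hr => ?_).trans (measure_union_le _ _)
    rcases lt_or_ge (r : ℝ) 1 with h | h
    · exact Or.inl h
    · exact Or.inr ⟨h, hr⟩
  rw [h1, h2, add_zero, ENNReal.ofReal_le_ofReal_iff (by positivity),
    div_le_div_iff_of_pos_right (by positivity)] at h3
  simp only [one_pow] at h3
  exact absurd h3 (not_le.mpr (one_lt_pow₀ one_lt_two (Nat.succ_ne_zero m)))

/-- The angular factor of a homogeneous function is measurable, and integrable in the same powers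
as the function itself. -/
theorem angular_integrable (hn : n ≠ 0) {u w : E n → ℝ} {b s : ℝ}
    (hu : MemL2Loc {0}ᶜ u) (huL : LocallyIntegrableOn (fun x => |u x| ^ s) {0}ᶜ volume)
    (hhom : ∀ᵐ x, u x = ‖x‖ ^ b * w (‖x‖⁻¹ • x)) :
    AEStronglyMeasurable (fun θ : Metric.sphere (0 : E n) 1 => w θ) (sphereMeasure n) ∧
      Integrable (fun θ : Metric.sphere (0 : E n) 1 => |w θ| ^ s) (sphereMeasure n) := by
  have hΦ := measurePreserving_polarMap (n := n) hn
  have hKc : IsCompact {x : E n | 1 ≤ ‖x‖ ∧ ‖x‖ ≤ 2} := by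
    refine Metric.isCompact_of_isClosed_isBounded ((isClosed_le continuous_const
      continuous_norm).inter (isClosed_le continuous_norm continuous_const)) ?_
    exact (Metric.isBounded_closedBall (x := (0 : E n)) (r := 2)).subset fun x hx => by
      simpa using hx.2
  obtain ⟨K, hK⟩ : ∃ K : Set (E n), K = {x : E n | 1 ≤ ‖x‖ ∧ ‖x‖ ≤ 2} := ⟨_, rfl⟩
  rw [← hK] at hKc
  have hK0 : K ⊆ {0}ᶜ := by
    rintro x hx (rfl : x = 0)
    rw [hK] at hx
    have := hx.1
    rw [norm_zero] at this
    linarith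
  have h1 : AEStronglyMeasurable (K.indicator u) volume :=
    (aestronglyMeasurable_indicator_iff hKc.measurableSet).mpr (hu K hKc hK0).1
  have h2 : Integrable (K.indicator fun x => |u x| ^ s) volume :=
    (integrable_indicator_iff hKc.measurableSet).mpr
      (huL.integrableOn_compact_subset hK0 hKc)
  have h1' := (h1.comp_measurePreserving hΦ).prodMk_left
  have h2' := ((hΦ.integrable_comp h2.1).mpr h2).prod_right_ae
  have h3 := Measure.ae_ae_of_ae_prod (hΦ.quasiMeasurePreserving.ae hhom)
  -- By Fubini some sphere of radius `r` in the shell carries measurability, integrability and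
  -- homogeneity at once; there `w` is `u` up to the constant `r^b`.
  obtain ⟨r, ⟨hr1, hr2⟩, h1, h2, h3⟩ : ∃ r : Set.Ioi (0 : ℝ), (1 ≤ (r : ℝ) ∧ (r : ℝ) < 2) ∧
      AEStronglyMeasurable (fun θ => (K.indicator u ∘ polarMap n) (r, θ)) (sphereMeasure n) ∧
      Integrable (fun θ => ((K.indicator fun x => |u x| ^ s) ∘ polarMap n) (r, θ))
        (sphereMeasure n) ∧
      ∀ᵐ θ ∂sphereMeasure n, u (polarMap n (r, θ)) = ‖polarMap n (r, θ)‖ ^ b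
        * w (‖polarMap n (r, θ)‖⁻¹ • polarMap n (r, θ)) := by
    by_contra hc
    refine volumeIoiPow_shell_ne_zero (n - 1) (measure_mono_null ?_
      (ae_iff.mp ((h1'.and h2').and h3)))
    rintro r hr ⟨⟨h4, h5⟩, h6⟩
    exact hc ⟨r, hr, h4, h5, h6⟩
  have hr0 : (0 : ℝ) < r := r.2
  have hrK : ∀ θ, polarMap n (r, θ) ∈ K := fun θ => by
    rw [hK, Set.mem_ofPred_eq, norm_polarMap]
    exact ⟨hr1, hr2.le⟩
  have hrb : ((r : ℝ) ^ b) ≠ 0 := (Real.rpow_pos_of_pos hr0 b).ne'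
  simp only [normalize_polarMap] at h3
  simp only [norm_polarMap] at h3
  simp only [Function.comp_apply, Set.indicator_of_mem (hrK _)] at h1 h2
  have hw : ∀ᵐ θ : Metric.sphere (0 : E n) 1 ∂sphereMeasure n,
      ((r : ℝ) ^ b)⁻¹ * u (polarMap n (r, θ)) = w θ := by
    filter_upwards [h3] with θ hθ
    rw [hθ, inv_mul_cancel_left₀ hrb]
  refine ⟨(h1.const_mul _).congr hw, (h2.const_mul (|((r : ℝ) ^ b)⁻¹| ^ s)).congr ?_⟩
  filter_upwards [hw] with θ hθ
  rw [← hθ, abs_mul, Real.mul_rpow (abs_nonneg _) (abs_nonneg _)]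

theorem ae_eq_zero_of_angular (hn : n ≠ 0) {u w : E n → ℝ} {b : ℝ}
    (hhom : ∀ᵐ x, u x = ‖x‖ ^ b * w (‖x‖⁻¹ • x))
    (hw : ∀ᵐ θ : Metric.sphere (0 : E n) 1 ∂sphereMeasure n, w θ = 0) : ∀ᵐ x, u x = 0 := by
  have hΦ := measurePreserving_polarMap (n := n) hn
  have h : ∀ᵐ x : E n, w (‖x‖⁻¹ • x) = 0 := by
    rw [← hΦ.map_eq, measurableEmbedding_polarMap.ae_map_iff]
    simp only [normalize_polarMap]
    exact Measure.quasiMeasurePreserving_snd.ae hw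
  filter_upwards [hhom, h] with x h1 h2
  rw [h1, h2, mul_zero]

/-! ### The comparison on the sphere -/

theorem abs_rpow_sub_one_mul_sq {p : ℝ} (hp : 1 < p) (y : ℝ) :
    |y| ^ (p - 1) * y ^ 2 = |y| ^ (p + 1) := by
  rw [show p + 1 = p - 1 + 2 by ring, Real.rpow_add_of_nonneg (abs_nonneg _) (by linarith)
    (by norm_num), Real.rpow_two, sq_abs]

theorem rpow_le_one_add_rpow {y a b : ℝ} (hy : 0 ≤ y) (ha : 0 ≤ a) (hab : a ≤ b) :
    y ^ a ≤ 1 + y ^ b := by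
  have h0 := Real.rpow_nonneg hy b
  rcases le_total y 1 with h | h
  · linarith [Real.rpow_le_one hy h ha]
  · linarith [Real.rpow_le_rpow_of_exponent_le h hab]

theorem integrable_abs_rpow {α : Type*} [MeasurableSpace α] {μ : Measure α} [IsFiniteMeasure μ]
    {f : α → ℝ} (hf : AEStronglyMeasurable f μ) {a b : ℝ} (ha : 0 ≤ a) (hab : a ≤ b)
    (h : Integrable (fun x => |f x| ^ b) μ) : Integrable (fun x => |f x| ^ a) μ := by
  refine ((integrable_const (1 : ℝ)).add h).mono' ?_ (.of_forall fun x => ?_)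
  · exact (hf.aemeasurable.abs.pow_const a).aestronglyMeasurable
  · rw [Real.norm_of_nonneg (Real.rpow_nonneg (abs_nonneg _) _)]
    exact rpow_le_one_add_rpow (abs_nonneg _) ha hab

open Filter Topology in
/-- If the quadratic form of the equation dominates that of stability, the angular factor
vanishes. -/
theorem angular_eq_zero (hn : n ≠ 0) {w : E n → ℝ} {p κ : ℝ} (hp : 1 < p) (hκ0 : 0 < κ)
    (hκ1 : κ < 1)
    (hwm : AEStronglyMeasurable (fun θ : Metric.sphere (0 : E n) 1 => w θ) (sphereMeasure n))
    (hwi : Integrable (fun θ : Metric.sphere (0 : E n) 1 => |w θ| ^ (p + 1)) (sphereMeasure n))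
    {e₁ e₂ e₃ s₁ s₂ s₃ : ℝ} (h0 : 1 ≤ κ * p) (h1 : s₁ ≤ κ * p * e₁) (h2 : s₂ ≤ κ * p * e₂)
    (h3 : s₃ ≤ κ * p * e₃)
    (heq : ∀ q : HomZero n, ∫ θ, |w θ| ^ (p - 1) * w θ * q.1 θ ∂sphereMeasure n
      = e₃ * ∫ θ, w θ * q.1 θ ∂sphereMeasure n
        - e₂ * ∫ θ, w θ * (HomZero.lap q).1 θ ∂sphereMeasure n
        + e₁ * ∫ θ, w θ * (HomZero.lap (HomZero.lap q)).1 θ ∂sphereMeasure n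
        - ∫ θ, w θ * (HomZero.lap (HomZero.lap (HomZero.lap q))).1 θ ∂sphereMeasure n)
    (hst : ∀ q : HomZero n, p * ∫ θ, |w θ| ^ (p - 1) * q.1 θ ^ 2 ∂sphereMeasure n
      ≤ s₃ * HomZero.ip q q - s₂ * HomZero.ip q (HomZero.lap q)
        + s₁ * HomZero.ip q (HomZero.lap (HomZero.lap q))
        - HomZero.ip q (HomZero.lap (HomZero.lap (HomZero.lap q)))) :
    ∀ᵐ θ : Metric.sphere (0 : E n) 1 ∂sphereMeasure n, w θ = 0 := by
  have hp0 : 0 < p := by linarith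
  have hw2 : MemLp (fun θ : Metric.sphere (0 : E n) 1 => w θ) 2 (sphereMeasure n) := by
    rw [memLp_two_iff_integrable_sq hwm]
    have := integrable_abs_rpow hwm (a := 2) (by norm_num) (by linarith) hwi
    simpa [Real.rpow_two, sq_abs] using this
  have hip1 : Integrable (fun θ : Metric.sphere (0 : E n) 1 => |w θ| ^ (p - 1))
    (sphereMeasure n) := integrable_abs_rpow hwm (by linarith) (by linarith) hwi
  have hip : Integrable (fun θ : Metric.sphere (0 : E n) 1 => |w θ| ^ (p - 1) * w θ)
      (sphereMeasure n) := by
    have h := integrable_abs_rpow hwm (a := p) (by linarith) (by linarith) hwi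
    refine h.mono (hip1.1.mul hwm) (.of_forall fun θ => ?_)
    rw [norm_mul, Real.norm_of_nonneg (Real.rpow_nonneg (abs_nonneg _) _),
      Real.norm_of_nonneg (Real.rpow_nonneg (abs_nonneg _) _), Real.norm_eq_abs]
    nth_rw 2 [← Real.rpow_one |w θ|]
    rw [← Real.rpow_add_of_nonneg (abs_nonneg _) (by linarith) (by norm_num), sub_add_cancel]
  have hcont : ∀ {f : Metric.sphere (0 : E n) 1 → ℝ}, Integrable f (sphereMeasure n) →
      ∀ {g : Metric.sphere (0 : E n) 1 → ℝ}, Continuous g →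
        Integrable (fun θ => f θ * g θ) (sphereMeasure n) := by
    intro f hf g hg
    have := (hf.integrableOn (s := Set.univ)).mul_continuousOn hg.continuousOn isCompact_univ
    simpa using this
  have hsq : ∀ q : HomZero n, Integrable (fun θ : Metric.sphere (0 : E n) 1 =>
      |w θ| ^ (p - 1) * q.1 θ ^ 2) (sphereMeasure n) := fun q =>
    hcont hip1 (g := fun θ => q.1 θ ^ 2) ((HomZero.continuous_sphere q).pow 2)
  obtain ⟨ψ, hψ, hψlim⟩ := HomZero.exists_approx hw2
  obtain ⟨I, hI⟩ : ∃ I, I = ∫ θ, |w θ| ^ (p + 1) ∂sphereMeasure n := ⟨_, rfl⟩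
  have hI0 : 0 ≤ I := by
    rw [hI]; exact integral_nonneg fun θ => Real.rpow_nonneg (abs_nonneg _) _
  have hY : ∀ m, (2 - κ) * ∫ θ, |w θ| ^ (p - 1) * (ψ m).1 θ ^ 2 ∂sphereMeasure n ≤ κ * I := by
    intro m
    obtain ⟨W, hmem, hlap, hW⟩ := hψ m
    obtain ⟨q, hq⟩ : ∃ q, q = ψ m := ⟨_, rfl⟩
    rw [← hq] at hmem hW ⊢
    have hX := heq q
    have hl1 := hlap hmem
    have hl2 := hlap hl1
    -- The space is `L`-invariant, so `w` may be replaced by its projection `q` in every linear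
    -- term: the right side becomes `⟨q, A q⟩`.
    rw [hW q hmem, hW _ hl1, hW _ hl2, hW _ (hlap hl2)] at hX
    have m0 := HomZero.ip_self_nonneg q
    have m1 := HomZero.ip_lap_nonpos hn q
    have m2 : 0 ≤ HomZero.ip q (HomZero.lap (HomZero.lap q)) := by
      rw [← HomZero.ip_lap_left hn]; exact HomZero.ip_self_nonneg _
    have m3 : HomZero.ip q (HomZero.lap (HomZero.lap (HomZero.lap q))) ≤ 0 := by
      rw [← HomZero.ip_lap_left hn]; exact HomZero.ip_lap_nonpos hn _
    have hS := hst q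
    -- All moments `⟨q, (-L)^j q⟩` are nonnegative, so the coefficientwise bounds give `⟨q, B q⟩ ≤ κ
    -- p ⟨q, A q⟩`.
    have k0 := mul_le_mul_of_nonneg_right h0 (neg_nonneg.mpr m3)
    have k1 := mul_le_mul_of_nonneg_right h1 m2
    have k2 := mul_le_mul_of_nonneg_right h2 (neg_nonneg.mpr m1)
    have k3 := mul_le_mul_of_nonneg_right h3 m0
    have hYX : ∫ θ, |w θ| ^ (p - 1) * q.1 θ ^ 2 ∂sphereMeasure n
        ≤ κ * ∫ θ, |w θ| ^ (p - 1) * w θ * q.1 θ ∂sphereMeasure n := by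
      refine le_of_mul_le_mul_left ?_ hp0
      rw [hX]
      linarith
    -- From `|w|^(p-1) (w - q)² ≥ 0`. With `Y` and `X` the integrals of `|w|^(p-1) q²` and
    -- `|w|^(p-1) w q`, the bounds `Y ≤ κ X` and `2 X ≤ I + Y` give `(2 - κ) Y ≤ κ I`.
    have hcs : 2 * ∫ θ, |w θ| ^ (p - 1) * w θ * q.1 θ ∂sphereMeasure n
        ≤ I + ∫ θ, |w θ| ^ (p - 1) * q.1 θ ^ 2 ∂sphereMeasure n := by
      rw [hI, ← integral_const_mul, ← integral_add hwi (hsq q)]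
      refine integral_mono ((hcont hip (HomZero.continuous_sphere q)).const_mul 2)
        (hwi.add (hsq q)) fun θ => ?_
      have := mul_nonneg (Real.rpow_nonneg (abs_nonneg (w θ)) (p - 1))
        (sq_nonneg (w θ - q.1 θ))
      simp only [← abs_rpow_sub_one_mul_sq hp]
      linarith
    have := mul_le_mul_of_nonneg_left hcs hκ0.le
    linarith
  have hfatou : ENNReal.ofReal I ≤ ENNReal.ofReal (κ * I / (2 - κ)) := by
    have hw' : ∀ m, AEMeasurable (fun θ : Metric.sphere (0 : E n) 1 =>
        ENNReal.ofReal (|w θ| ^ (p - 1) * (ψ m).1 θ ^ 2)) (sphereMeasure n) := fun m =>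
      (hsq (ψ m)).1.aemeasurable.ennreal_ofReal
    rw [hI, ofReal_integral_eq_lintegral_ofReal hwi
      (.of_forall fun θ => Real.rpow_nonneg (abs_nonneg _) _), ← hI]
    calc ∫⁻ θ, ENNReal.ofReal (|w θ| ^ (p + 1)) ∂sphereMeasure n
        = ∫⁻ θ, liminf (fun m => ENNReal.ofReal (|w θ| ^ (p - 1) * (ψ m).1 θ ^ 2)) atTop
            ∂sphereMeasure n := by
          refine lintegral_congr_ae ?_
          filter_upwards [hψlim] with θ hθ
          rw [← abs_rpow_sub_one_mul_sq hp]
          exact ((ENNReal.continuous_ofReal.tendsto _).comp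
            ((hθ.pow 2).const_mul (|w θ| ^ (p - 1)))).liminf_eq.symm
      _ ≤ liminf (fun m => ∫⁻ θ, ENNReal.ofReal (|w θ| ^ (p - 1) * (ψ m).1 θ ^ 2)
            ∂sphereMeasure n) atTop := lintegral_liminf_le' hw'
      _ ≤ _ := by
          refine liminf_le_of_le (by isBoundedDefault) fun c hc => ?_
          obtain ⟨m, hm⟩ := hc.exists
          refine hm.trans ?_
          rw [← ofReal_integral_eq_lintegral_ofReal (hsq (ψ m))
            (.of_forall fun θ => mul_nonneg (Real.rpow_nonneg (abs_nonneg _) _) (sq_nonneg _))]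
          refine ENNReal.ofReal_le_ofReal ?_
          rw [le_div_iff₀ (by linarith), mul_comm]
          exact hY m
  rw [ENNReal.ofReal_le_ofReal_iff (div_nonneg (by positivity) (by linarith)),
    le_div_iff₀ (by linarith)] at hfatou
  -- Fatou's lemma has given `(2 - κ) I ≤ κ I`, and `κ < 1` leaves only `I = 0`.
  have hIz : I = 0 := by nlinarith
  rw [hI, integral_eq_zero_iff_of_nonneg (fun θ => Real.rpow_nonneg (abs_nonneg _) _) hwi] at hIz
  filter_upwards [hIz] with θ hθ
  have := (Real.rpow_eq_zero (abs_nonneg (w θ)) (by linarith)).mp hθ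
  exact abs_eq_zero.mp this

end Triharmonic

end

open Triharmonic in
theorem theorem4p1 (n : ℕ) (hn : 7 ≤ n) (p : ℝ)
    (hp : ((n : ℝ) + 6) / ((n : ℝ) - 6) < p)
    (hpc : (p : EReal) < josephLundgrenExponent n)
    (u : E n → ℝ)
    (huW : MemW2Loc ({0}ᶜ : Set (E n)) 3 u)
    (huL : LocallyIntegrableOn (fun x => |u x| ^ (p + 1)) ({0}ᶜ : Set (E n)) volume)
    (hhom : ∃ w : E n → ℝ, ∀ᵐ x : E n, u x = ‖x‖ ^ (-(6 / (p - 1))) * w (‖x‖⁻¹ • x))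
    (hsol : IsWeakSolution ({0}ᶜ : Set (E n)) p u)
    (hstab : IsStable ({0}ᶜ : Set (E n)) p u) :
    ∀ᵐ x : E n, u x = 0 := by
  have hn0 : n ≠ 0 := by omega
  have hn' : (7 : ℝ) ≤ n := by exact_mod_cast hn
  have hp1 : 1 < p := lt_trans (by rw [lt_div_iff₀] <;> linarith) hp
  have hk : 6 / (p - 1) * (p - 1) = 6 := div_mul_cancel₀ _ (by linarith)
  have hu2 : MemL2Loc {0}ᶜ u := huW.1
  obtain ⟨w, hw⟩ := hhom
  obtain ⟨hwm, hwi⟩ := angular_integrable hn0 hu2 huL hw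
  obtain ⟨κ, hκ0, hκ1, h0, h1, h2, h3⟩ := symbol_ineq hn hp hpc rfl rfl rfl rfl rfl rfl
  exact ae_eq_zero_of_angular hn0 hw (angular_eq_zero hn0 hp1 hκ0 hκ1 hwm hwi h0 h1 h2 h3
    (sphere_equation hn0 hk hu2 hw hsol rfl rfl rfl)
    (sphere_stability hn0 hk hw hstab rfl rfl))
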